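/- Let $\mathbf M$ be a finite set of integral vectors $m=(c,d)$, each in lowest terms (so non-zero), no two of them parallel (the basic moves of a chess piece $\mathbb P$), and let $q\ge 1$. For $i\neq j$ in $[q]$ and $m=(c,d)\in\mathbf M$, the move hyperplane $\mathcal H^{d/c}_{ij}$ is the set of $(z_1,\dots,z_q)\in(\mathbb R^2)^q$ with $(z_j-z_i)\cdot(d,-c)=0$. Let $\mathcal U\subseteq\mathbb R^{2q}$ be an intersection of move hyperplanes whose equations involve exactly $\kappa$ of the $q$ pieces (indices), let $\tilde{\mathcal U}\subseteq\mathbb R^{2\kappa}$ be the subspace that satisfies the same equations, and let $$\alpha(\mathcal U;n)=\#\Big((n+1)\cdot\big((0,1)^{2\kappa}\cap\tilde{\mathcal U}\big)\cap\mathbb Z^{2\kappa}\Big)\qquad(n\ge 0).$$ Put $\nu=\operatorname{codim}\mathcal U$ and $d=2\kappa-\nu\ge0$. Then $\alpha(\mathcal U;n)$ is a quasipolynomial in $n$. Let $p\ge1$ be a period of it (not necessarily the smallest). Then $\alpha(\mathcal U;n)=\alpha_{n\bmod p}(n)$ for all $n\ge 0$, with constituents $\alpha_i\in\mathbb Q[n]$,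 $i\in\mathbb Z/p$, that have degree $d$, a common leading coefficient, and the parity symmetry $\alpha_{-i}(-n)=(-1)^d\alpha_i(n)$. The number of values of $\alpha(\mathcal U;n)$ that are sufficient to determine all coefficients of all constituents is $$N=\big\lceil p\big(\kappa-\tfrac12\operatorname{codim}\mathcal U\big)\big\rceil+\epsilon,\qquad \epsilon=\begin{cases}1&\text{if }\operatorname{codim}\mathcal U\text{ is even},\\0&\text{if it is odd,}\end{cases}$$ in the following sense. Consider all systems $(\beta_i)_{i\in\mathbb Z/p}$ of polynomials over $\mathbb Q$ of degree at most $d$, with the same coefficient of $n^d$ in all of them and with $\beta_{-i}(-n)=(-1)^d\beta_i(n)$. (a) If such a system satisfies $\beta_{n\bmod p}(n)=\alpha(\mathcal U;n)$ for $n=1,\dots,N$, then $\beta_i=\alpha_i$ for all $i$. (b) For every set $S$ of fewer than $N$ integers $n\ge 0$ there is such a system, with all $\beta_i$ of degree exactly $d$, that satisfies $\beta_{n\bmod p}(n)=\alpha(\mathcal U;n)$ for all $n\in S$ but is different from $(\alpha_i)$. -/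

import Mathlib

open scoped Pointwise

noncomputable section

/-- A set of basic moves `(c, d)`: a finite set of integral vectors in lowest terms (in particular
non-zero), no two distinct ones of which are parallel. -/
def IsMoveSet (M : Finset (ℤ × ℤ)) : Prop :=
  (∀ m ∈ M, IsCoprime m.1 m.2) ∧
    ∀ m ∈ M, ∀ m' ∈ M, m ≠ m' → m.1 * m'.2 - m.2 * m'.1 ≠ 0

/-- The move hyperplane of the pieces `i`, `j` for the move `m = (c, d)`: the configurations `z` with
`(z j - z i) · (d, -c) = 0`. -/
def moveHyperplane {ι : Type} (i j : ι) (m : ℤ × ℤ) : Submodule ℝ (ι → ℝ × ℝ) where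
  carrier := {z | ((z j).1 - (z i).1) * (m.2 : ℝ) + ((z j).2 - (z i).2) * (-(m.1 : ℝ)) = 0}
  zero_mem' := by simp
  add_mem' := by
    intro a b ha hb
    simp only [Set.mem_ofPred_eq, Pi.add_apply, Prod.fst_add, Prod.snd_add] at *
    linear_combination ha + hb
  smul_mem' := by
    intro r a ha
    simp only [Set.mem_ofPred_eq, Pi.smul_apply, Prod.smul_fst, Prod.smul_snd, smul_eq_mul] at *
    linear_combination r * ha

/-- The attack equations of `q` pieces with move set `M`; `(i, j, m)` stands for the equation of
`moveHyperplane i j m`. -/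
def attackEquations (M : Finset (ℤ × ℤ)) (q : ℕ) : Set (Fin q × Fin q × (ℤ × ℤ)) :=
  {e | e.1 ≠ e.2.1 ∧ e.2.2 ∈ M}

/-- The subspace of `ℝ^(2q)` cut out by a set `E` of attack equations. As `E` runs through the sets
of attack equations of a piece, these are the elements of the intersection lattice of its move
arrangement. -/
def attackSubspace {q : ℕ} (E : Set (Fin q × Fin q × (ℤ × ℤ))) :
    Submodule ℝ (Fin q → ℝ × ℝ) :=
  ⨅ e ∈ E, moveHyperplane e.1 e.2.1 e.2.2

/-- The set of pieces that are involved in the equations `E`. -/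
def involvedPieces {q : ℕ} (E : Set (Fin q × Fin q × (ℤ × ℤ))) : Set (Fin q) :=
  {i | ∃ e ∈ E, i = e.1 ∨ i = e.2.1}

/-- The essential part: the subspace of `ℝ^(2κ)` (with coordinates indexed by the `κ` involved
pieces) that satisfies the same attack equations. -/
def essentialPart {q : ℕ} (E : Set (Fin q × Fin q × (ℤ × ℤ))) :
    Submodule ℝ (involvedPieces E → ℝ × ℝ) :=
  ⨅ (i : involvedPieces E) (j : involvedPieces E) (m : ℤ × ℤ)
    (_ : ((i : Fin q), (j : Fin q), m) ∈ E), moveHyperplane i j m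

/-- The codimension of a subspace. -/
def codim {ι : Type} (U : Submodule ℝ (ι → ℝ × ℝ)) : ℕ :=
  Module.finrank ℝ ((ι → ℝ × ℝ) ⧸ U)

/-- The open cube `(0,1)^(2κ)`, where `κ` is the number of elements of `ι`. -/
def openCube (ι : Type) : Set (ι → ℝ × ℝ) :=
  {z | ∀ i, z i ∈ Set.Ioo (0 : ℝ) 1 ×ˢ Set.Ioo (0 : ℝ) 1}

/-- The Ehrhart counting function: the number of integral points in the dilation `t • X`. -/
def ehrhart {ι : Type} (X : Set (ι → ℝ × ℝ)) (t : ℕ) : ℕ :=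
  Set.ncard {z : ι → ℤ × ℤ | (fun i => (((z i).1 : ℝ), ((z i).2 : ℝ))) ∈ (t : ℝ) • X}

/-- `α(U; n)` for the subspace `U` given by the equations `E`. -/
def alpha {q : ℕ} (E : Set (Fin q × Fin q × (ℤ × ℤ))) (n : ℕ) : ℕ :=
  ehrhart (openCube (involvedPieces E) ∩ (essentialPart E : Set (involvedPieces E → ℝ × ℝ)))
    (n + 1)

/-- `f` is the quasipolynomial with period `p` and constituents `c i`, `i ∈ ℤ/p`. -/
def IsQuasipolynomialWith (f : ℕ → ℕ) (p : ℕ) (c : ZMod p → Polynomial ℚ) : Prop :=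
  ∀ n : ℕ, (f n : ℚ) = (c (n : ZMod p)).eval (n : ℚ)

/-- `f` is a quasipolynomial that has period `p` (possibly not the smallest one). -/
def HasPeriod (f : ℕ → ℕ) (p : ℕ) : Prop :=
  0 < p ∧ ∃ c : ZMod p → Polynomial ℚ, IsQuasipolynomialWith f p c

/-- A system of `p` constituents of degree at most `d`, with the same coefficient of `n ^ d` in all
of them, that has the parity symmetry `c_{-i}(-n) = (-1)^d c_i(n)`. -/
structure IsParitySystem (p d : ℕ) (c : ZMod p → Polynomial ℚ) : Prop where
  degree_le : ∀ i, (c i).degree ≤ (d : WithBot ℕ)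
  leading_eq : ∀ i j, (c i).coeff d = (c j).coeff d
  parity : ∀ i, ∀ x : ℚ, (c (-i)).eval (-x) = (-1) ^ d * (c i).eval x

/-- `⌈p (κ - ν / 2)⌉ + ε`, with `ε = 1` if `ν` is even and `ε = 0` if `ν` is odd. -/
def numValues (p κ ν : ℕ) : ℕ :=
  ⌈(p : ℚ) * ((κ : ℚ) - (ν : ℚ) / 2)⌉₊ + if Even ν then 1 else 0

end

/-! Two ideas carry the theorem: Ehrhart reciprocity for `α`, and a count of the parameters of a
system with parity symmetry.

Reciprocity. Let `L` be the lattice of integral solutions of the equations. Its rank `d` equals the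
real dimension `2κ - ν`, because the real solutions are spanned by integral ones, and `α(n)` counts
the points of `L` in the open cube of edge `n + 1`. The all-ones vector lies in `L`, so translation
by it identifies the points in the closed cube of edge `t` with those in the open cube of edge `t +
2`. Reciprocity says that the closed count at `t` and, up to sign, the open count at `-t` glue to
one quasipolynomial on `ℤ`. Recentred at `t = n - 1` it becomes its own mirror image, which is the
parity symmetry. The common leading coefficient comes from monotonicity of `α`, and its positivity
from the bound `exists_pow_le_openCount`.

Reciprocity itself (`IsGradedCone.isQuasipoly`) is proved by Elliott's reduction, without
triangulations or generating functions. The cone over the cube is cut into half-open orthants, and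
these are cut along walls `x_i = x_j` and sheared back to orthants, until each defining form has
entries of one sign. Every piece is then empty or a whole half-open orthant, where the count
satisfies a first-order difference equation. Strictness flags make the cuts disjoint; the open cone
is cut with the complementary flags, and an interior point of the cone decides which flags are used.

Counting. Systems with a common leading coefficient have `pd + 1` parameters. Parity costs `⌊pd/2⌋ +
1 - ε` linear conditions, `ε` being `1` for even `d` and `0` for odd `d`, which leaves `⌈pd/2⌉ + ε =
N` parameters. Fewer than `N` values therefore leave a nonzero system vanishing at all of them
(`exists_isParitySystem_ne_zero`). Conversely, zeros at `1, …, N` reflect to zeros at `-1, …, -N`,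
and the pigeonhole principle gives one constituent more than `d` zeros. It vanishes, so the common
leading coefficient does, and the zeros suffice for all other constituents
(`IsParitySystem.eq_zero`). -/

open Polynomial in
/-- `g` is a quasipolynomial of period `p` with constituents of degree less than `m`. -/
def HasQuasiperiod (p m : ℕ) (g : ℤ → ℚ) : Prop :=
  ∀ r : ℤ, ∃ q : ℚ[X], q.degree < m ∧ ∀ k : ℤ, g (r + p * k) = q.eval (k : ℚ)

/-- `g` is a quasipolynomial with constituents of degree less than `m`. -/
def IsQuasipoly (m : ℕ) (g : ℤ → ℚ) : Prop :=
  ∃ p : ℕ, 0 < p ∧ HasQuasiperiod p m g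

/-! ### Quasipolynomials on the integers and their difference equations -/

section Quasipolynomials

open Polynomial

lemma degree_comp_linear_lt {q : ℚ[X]} {m : ℕ} (hq : q.degree < m) (a b : ℚ) :
    (q.comp (C a * X + C b)).degree < m := by
  rcases Nat.eq_zero_or_pos m with rfl | hm
  · have : q = 0 := by
      by_contra h
      have := zero_le_degree_iff.2 h
      exact absurd (lt_of_le_of_lt this hq) (by simp)
    subst this
    simp
  · have h1 : q.natDegree < m := by
      rcases eq_or_ne q 0 with rfl | h
      · simpa using hm
      · exact (natDegree_lt_iff_degree_lt h).2 hq
    refine lt_of_le_of_lt degree_le_natDegree ?_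
    refine Nat.cast_lt.2 (lt_of_le_of_lt (natDegree_comp_le (p := q)) ?_)
    calc q.natDegree * (C a * X + C b).natDegree ≤ q.natDegree * 1 :=
          Nat.mul_le_mul_left _ natDegree_linear_le
      _ < m := by simpa using h1

lemma coeff_comp_linear {q : ℚ[X]} {d : ℕ} (hq : q.degree ≤ d) (a b : ℚ) :
    (q.comp (C a * X + C b)).coeff d = a ^ d * q.coeff d := by
  have h0 : (q - monomial d (q.coeff d)).degree < d := by
    refine (degree_lt_iff_coeff_zero _ _).2 fun m hm => ?_
    rcases eq_or_lt_of_le hm with rfl | h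
    · simp
    · rw [coeff_sub, coeff_monomial, if_neg (by omega), sub_zero]
      exact coeff_eq_zero_of_degree_lt (lt_of_le_of_lt hq (Nat.cast_lt.2 h))
  have h1 := degree_comp_linear_lt h0 a b
  have h2 : q = (q - monomial d (q.coeff d)) + monomial d (q.coeff d) := by ring
  have h4 : ((C a * X + C b : ℚ[X]) ^ d).coeff d = a ^ d := by
    have h := coeff_pow_of_natDegree_le (p := (C a * X + C b : ℚ[X])) (m := d) (n := 1)
      natDegree_linear_le
    simpa using h
  conv_lhs => rw [h2]
  rw [add_comp, coeff_add, coeff_eq_zero_of_degree_lt h1, zero_add, monomial_comp, coeff_C_mul, h4,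
    mul_comm]

lemma HasQuasiperiod.mul {p m : ℕ} {g : ℤ → ℚ} (h : HasQuasiperiod p m g) (l : ℕ) :
    HasQuasiperiod (p * l) m g := by
  intro r
  obtain ⟨q, hq, hg⟩ := h r
  refine ⟨q.comp (C (l : ℚ) * X + C 0), degree_comp_linear_lt hq _ _, fun k => ?_⟩
  have := hg (l * k)
  push_cast at this ⊢
  rw [← mul_assoc] at this
  simp [this]

lemma HasQuasiperiod.add {p m : ℕ} {g g' : ℤ → ℚ} (h : HasQuasiperiod p m g)
    (h' : HasQuasiperiod p m g') : HasQuasiperiod p m (g + g') := by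
  intro r
  obtain ⟨q, hq, hg⟩ := h r
  obtain ⟨q', hq', hg'⟩ := h' r
  exact ⟨q + q', lt_of_le_of_lt (degree_add_le _ _) (max_lt hq hq'), fun k => by
    simp [hg, hg']⟩

lemma isQuasipoly_zero (m : ℕ) : IsQuasipoly m 0 :=
  ⟨1, one_pos, fun _ => ⟨0, by simp, by simp⟩⟩

lemma IsQuasipoly.add {m : ℕ} {g g' : ℤ → ℚ} (h : IsQuasipoly m g) (h' : IsQuasipoly m g') :
    IsQuasipoly m (g + g') := by
  obtain ⟨p, hp, h⟩ := h
  obtain ⟨p', hp', h'⟩ := h'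
  exact ⟨p * p', by positivity, (h.mul p').add (mul_comm p' p ▸ h'.mul p)⟩

lemma IsQuasipoly.comp_add {m : ℕ} {g : ℤ → ℚ} (h : IsQuasipoly m g) (a : ℤ) :
    IsQuasipoly m fun t => g (t + a) := by
  obtain ⟨p, hp, h⟩ := h
  refine ⟨p, hp, fun r => ?_⟩
  obtain ⟨q, hq, hg⟩ := h (r + a)
  exact ⟨q, hq, fun k => by rw [← hg k]; ring_nf⟩

/-- Bernoulli polynomials satisfy `B_{k+1}(x + 1) - B_{k+1}(x) = (k + 1) x^k`, so they integrate
monomials discretely. -/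
lemma exists_discrete_antiderivative {m : ℕ} {q : ℚ[X]} (hq : q.degree < m) :
    ∃ R : ℚ[X], R.degree < (m + 1 : ℕ) ∧ ∀ x : ℚ, R.eval (x + 1) - R.eval x = q.eval x := by
  refine ⟨∑ k ∈ Finset.range m, C (q.coeff k / (k + 1 : ℕ)) * Polynomial.bernoulli (k + 1), ?_, ?_⟩
  · refine lt_of_le_of_lt (degree_sum_le _ _) ((Finset.sup_lt_iff (WithBot.bot_lt_coe _)).2 ?_)
    intro k hk
    have h1 : (Polynomial.bernoulli (k + 1)).degree ≤ (k + 1 : ℕ) := by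
      refine (degree_le_iff_coeff_zero _ _).2 fun n hn => ?_
      rw [coeff_bernoulli, if_neg]
      exact not_le.2 (Nat.cast_lt.1 hn)
    refine lt_of_le_of_lt ((degree_mul_le _ _).trans (add_le_add degree_C_le h1)) ?_
    rw [zero_add]
    have := Finset.mem_range.1 hk
    exact Nat.cast_lt.2 (by omega)
  · intro x
    have h2 : q.eval x = ∑ k ∈ Finset.range m, q.coeff k * x ^ k := by
      rcases eq_or_ne q 0 with rfl | h
      · simp
      · exact eval_eq_sum_range' ((natDegree_lt_iff_degree_lt h).2 hq) x
    rw [h2]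
    simp only [eval_finsetSum, eval_mul, eval_C, add_comm x 1, bernoulli_eval_one_add]
    rw [← Finset.sum_sub_distrib]
    refine Finset.sum_congr rfl fun k _ => ?_
    have : ((k + 1 : ℕ) : ℚ) ≠ 0 := by positivity
    field_simp
    push_cast
    ring

/-- If `p` is a period of the difference, then along steps of length `p * w` the increment of `g`
telescopes into `p` differences, each polynomial in the step number. A discrete antiderivative
raises the degree by one. -/
lemma IsQuasipoly.of_sub {m w : ℕ} (hw : 0 < w) {g : ℤ → ℚ}
    (h : IsQuasipoly m fun t => g t - g (t - w)) : IsQuasipoly (m + 1) g := by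
  obtain ⟨p, hp, h⟩ := h
  refine ⟨p * w, by positivity, fun r => ?_⟩
  choose q hq hg using h
  obtain ⟨R, hR, hRq⟩ := exists_discrete_antiderivative (m := m)
    (q := ∑ j ∈ Finset.range p, (q (r + (j + 1) * w)).comp (C (w : ℚ) * X + C 0)) (by
      refine lt_of_le_of_lt (degree_sum_le _ _) ((Finset.sup_lt_iff (WithBot.bot_lt_coe _)).2 ?_)
      exact fun j _ => degree_comp_linear_lt (hq _) _ _)
  have hstep : ∀ k : ℤ, g (r + (p * w : ℕ) * (k + 1)) - g (r + (p * w : ℕ) * k) =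
      R.eval ((k : ℚ) + 1) - R.eval (k : ℚ) := by
    intro k
    rw [hRq]
    have htel := Finset.sum_range_sub (fun j : ℕ => g (r + (p * w : ℕ) * k + j * w)) p
    have h1 : r + ((p * w : ℕ) : ℤ) * (k + 1) = r + (p * w : ℕ) * k + p * w := by push_cast; ring
    have h2 : r + ((p * w : ℕ) : ℤ) * k = r + (p * w : ℕ) * k + (0 : ℕ) * w := by simp
    rw [h1]
    conv_lhs => arg 2; rw [h2]
    rw [← htel, eval_finsetSum]
    refine Finset.sum_congr rfl fun j _ => ?_
    have := hg (r + (j + 1) * w) (w * k)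
    simp only [eval_comp, eval_add, eval_mul, eval_C, eval_X, add_zero]
    push_cast at this ⊢
    rw [← this]
    congr 2 <;> ring
  refine ⟨R + C (g r - R.eval 0), ?_, fun k => ?_⟩
  · refine lt_of_le_of_lt (degree_add_le _ _) (max_lt hR (lt_of_le_of_lt degree_C_le ?_))
    exact_mod_cast Nat.succ_pos m
  · have : g (r + (p * w : ℕ) * k) - R.eval (k : ℚ) = g r - R.eval 0 := by
      induction k using Int.induction_on with
      | zero => simp
      | succ k ih =>
        have := hstep k
        push_cast at this ih ⊢
        linarith
      | pred k ih =>
        have := hstep (-k - 1)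
        push_cast at this ih ⊢
        simp only [sub_add_cancel] at this
        linarith
    simp only [eval_add, eval_C]
    linarith

end Quasipolynomials

/-! ### Reciprocity for half-open orthants -/

section HalfOpenCones

variable {ι : Type*} [Fintype ι]

/-- The lower bound for an integral coordinate that is constrained by `0 ≤ x` or by `0 < x`. -/
def flagBound (s : Bool) : ℤ := if s then 0 else 1

lemma flagBound_nonneg (s : Bool) : 0 ≤ flagBound s := by cases s <;> simp [flagBound]

/-- The points of degree `t` in a half-open orthant. -/
def orthantSlice (w : ι → ℤ) (s : ι → Bool) (t : ℤ) : Set (ι → ℤ) :=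
  {k | (∀ i, flagBound (s i) ≤ k i) ∧ w ⬝ᵥ k = t}

lemma orthantSlice_finite {w : ι → ℤ} (hw : ∀ i, 0 < w i) (s : ι → Bool) (t : ℤ) :
    (orthantSlice w s t).Finite := by
  refine (Set.Finite.pi' fun _ : ι => Set.finite_Icc (0 : ℤ) t).subset fun k hk i => ?_
  have h0 : ∀ i, 0 ≤ k i := fun i => (flagBound_nonneg _).trans (hk.1 i)
  refine ⟨h0 i, ?_⟩
  rw [← hk.2]
  calc k i ≤ w i * k i := le_mul_of_one_le_left (h0 i) (hw i)
    _ ≤ w ⬝ᵥ k := Finset.single_le_sum (f := fun i => w i * k i)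
        (fun i _ => mul_nonneg (hw i).le (h0 i)) (Finset.mem_univ i)

/-- Either the coordinate `0` sits at its lower bound and can be dropped, or it can be decreased by
one. This is the factor `1 / (1 - x ^ w 0)` of the generating function. -/
lemma ncard_orthantSlice_succ {n : ℕ} {w : Fin (n + 1) → ℤ} (hw : ∀ i, 0 < w i)
    (s : Fin (n + 1) → Bool) (t : ℤ) :
    (orthantSlice w s t).ncard =
      (orthantSlice (Fin.tail w) (Fin.tail s) (t - flagBound (s 0) * w 0)).ncard +
        (orthantSlice w s (t - w 0)).ncard := by
  have hun : orthantSlice w s t =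
      (Fin.cons (α := fun _ => ℤ) (flagBound (s 0))) ''
        orthantSlice (Fin.tail w) (Fin.tail s) (t - flagBound (s 0) * w 0) ∪
      (fun k => k + Pi.single 0 1) '' orthantSlice w s (t - w 0) := by
    ext k
    constructor
    · rintro ⟨hk, ht⟩
      rcases eq_or_lt_of_le (hk 0) with h0 | h0
      · refine Or.inl ⟨Fin.tail k, ⟨fun i => hk i.succ, ?_⟩, ?_⟩
        · simp only [dotProduct, Fin.sum_univ_succ, Fin.tail] at ht ⊢
          rw [h0]
          linarith
        · rw [h0]
          exact Fin.cons_self_tail k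
      · refine Or.inr ⟨k - Pi.single 0 1, ⟨fun i => ?_, ?_⟩, by simp⟩
        · refine Fin.cases ?_ (fun i => ?_) i
          · simp only [Pi.sub_apply, Pi.single_eq_same]
            omega
          · simpa using hk i.succ
        · rw [dotProduct_sub, dotProduct_single, ht, mul_one]
    · rintro (⟨k, ⟨hk, ht⟩, rfl⟩ | ⟨k, ⟨hk, ht⟩, rfl⟩)
      · constructor
        · intro i
          refine Fin.cases ?_ (fun i => ?_) i
          · simp
          · exact hk i
        · simp only [dotProduct, Fin.sum_univ_succ, Fin.tail, Fin.cons_zero, Fin.cons_succ] at ht ⊢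
          linarith
      · constructor
        · intro i
          refine Fin.cases ?_ (fun i => ?_) i
          · have := hk 0
            simp only [Pi.add_apply, Pi.single_eq_same]
            omega
          · simpa using hk i.succ
        · simp only [dotProduct_add, dotProduct_single, ht]
          ring
  have hdisj : Disjoint ((Fin.cons (α := fun _ => ℤ) (flagBound (s 0))) ''
        orthantSlice (Fin.tail w) (Fin.tail s) (t - flagBound (s 0) * w 0))
      ((fun k => k + Pi.single 0 1) '' orthantSlice w s (t - w 0)) := by
    rw [Set.disjoint_left]
    rintro _ ⟨k, -, rfl⟩ ⟨k', ⟨hk', -⟩, h⟩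
    have h0 := congrFun h 0
    have := hk' 0
    simp only [Pi.add_apply, Pi.single_eq_same, Fin.cons_zero] at h0
    omega
  rw [hun, Set.ncard_union_eq hdisj ((orthantSlice_finite (fun i : Fin n => hw i.succ) _ _).image _)
    ((orthantSlice_finite hw _ _).image _), Set.ncard_image_of_injective _
    (Fin.cons_right_injective _), Set.ncard_image_of_injective _ (add_left_injective _)]

/-- The recursion for the flags `s` at `t` and the one for the complementary flags at `-(t - w 0)`
combine into a difference equation of step `w 0`. Its right side is the same expression in one
dimension less, since the bounds of complementary flags add up to `1`. -/
lemma isQuasipoly_orthantSlice_fin (n : ℕ) (w : Fin n → ℤ) (hw : ∀ i, 0 < w i)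
    (s : Fin n → Bool) :
    IsQuasipoly n fun t => ((orthantSlice w s t).ncard : ℚ) -
      (-1) ^ n * ((orthantSlice w (fun i => !s i) (-t)).ncard : ℚ) := by
  induction n with
  | zero =>
    convert isQuasipoly_zero 0 using 1
    ext t
    have : orthantSlice w s t = orthantSlice w (fun i => !s i) (-t) := by
      ext k
      simp [orthantSlice, dotProduct, eq_comm]
    simp [this]
  | succ n ih =>
    refine IsQuasipoly.of_sub (w := (w 0).toNat) (by have := hw 0; omega) ?_
    have h0 : ((w 0).toNat : ℤ) = w 0 := Int.toNat_of_nonneg (hw 0).le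
    rw [h0]
    convert (ih (Fin.tail w) (fun i => hw i.succ) (Fin.tail s)).comp_add
      (-(flagBound (s 0) * w 0)) using 1
    ext t
    have h1 := ncard_orthantSlice_succ hw s t
    have h2 := ncard_orthantSlice_succ hw (fun i => !s i) (-(t - w 0))
    have h3 : -(t - w 0) - w 0 = -t := by ring
    have h4 : -(t - w 0) - flagBound (!s 0) * w 0 = -(t + -(flagBound (s 0) * w 0)) := by
      cases s 0 <;> simp [flagBound]
      ring
    rw [h3, h4] at h2
    rw [h1, h2, ← sub_eq_add_neg]
    push_cast
    have h5 : (Fin.tail fun i => !s i) = fun i => !Fin.tail s i := rfl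
    rw [h5]
    ring

lemma isQuasipoly_orthantSlice (w : ι → ℤ) (hw : ∀ i, 0 < w i) (s : ι → Bool) :
    IsQuasipoly (Fintype.card ι) fun t => ((orthantSlice w s t).ncard : ℚ) -
      (-1) ^ Fintype.card ι * ((orthantSlice w (fun i => !s i) (-t)).ncard : ℚ) := by
  let e := Fintype.equivFin ι
  have key : ∀ (s : ι → Bool) (t : ℤ), (orthantSlice w s t).ncard =
      (orthantSlice (w ∘ e.symm) (s ∘ e.symm) t).ncard := by
    intro s t
    have : orthantSlice (w ∘ e.symm) (s ∘ e.symm) t =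
        (fun k : ι → ℤ => k ∘ e.symm) '' orthantSlice w s t := by
      ext k
      constructor
      · rintro ⟨hk, ht⟩
        refine ⟨k ∘ e, ⟨fun i => by simpa using hk (e i), ?_⟩, by ext i; simp⟩
        rw [← ht]
        simp only [dotProduct]
        exact Fintype.sum_equiv e _ _ (by simp)
      · rintro ⟨k, ⟨hk, ht⟩, rfl⟩
        refine ⟨fun i => hk _, ?_⟩
        rw [← ht]
        simp only [dotProduct]
        exact (Fintype.sum_equiv e _ _ (by simp)).symm
    rw [this, Set.ncard_image_of_injective _ e.symm.surjective.injective_comp_right]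
  have := isQuasipoly_orthantSlice_fin _ (w ∘ e.symm) (fun i => hw _) (s ∘ e.symm)
  simp only [key]
  exact this

end HalfOpenCones

/-! ### Reciprocity for cones in half-open orthants, and its additivity under cuts -/

section Reciprocity

variable {ι J : Type*} [Fintype ι]

/-- The points of degree `t` of the cone `A ≥ 0` in the half-open orthant given by the flags `s` on
the coordinates in `T`. -/
def closedSlice (T : Finset ι) (A : J → ι → ℤ) (w : ι → ℤ) (s : ι → Bool) (t : ℤ) :
    Set (ι → ℤ) :=
  {k | (∀ i ∈ T, flagBound (s i) ≤ k i) ∧ (∀ l, 0 ≤ A l ⬝ᵥ k) ∧ w ⬝ᵥ k = t}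

/-- The points of degree `t` of the open cone `A > 0` in the half-open orthant given by the flags `s`
on the coordinates in `T`. -/
def openSlice (T : Finset ι) (A : J → ι → ℤ) (w : ι → ℤ) (s : ι → Bool) (t : ℤ) :
    Set (ι → ℤ) :=
  {k | (∀ i ∈ T, flagBound (s i) ≤ k i) ∧ (∀ l, 0 < A l ⬝ᵥ k) ∧ w ⬝ᵥ k = t}

/-- Ehrhart reciprocity for the part of the cone `A ≥ 0` in a half-open orthant. The complementary
flags are used for the open cone. -/
def HasReciprocity (T : Finset ι) (A : J → ι → ℤ) (w : ι → ℤ) (s : ι → Bool) : Prop :=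
  IsQuasipoly (Fintype.card ι) fun t => ((closedSlice T A w s t).ncard : ℚ) -
    (-1) ^ Fintype.card ι * ((openSlice T A w (fun i => !s i) (-t)).ncard : ℚ)

/-- The cone `A ≥ 0` has the interior point `y`, is graded by `w`, and has finitely many points in
each degree. -/
structure IsGradedCone (A : J → ι → ℤ) (w y : ι → ℤ) : Prop where
  interior : ∀ l, 0 < A l ⬝ᵥ y
  degree_pos : ∀ k, (∀ l, 0 ≤ A l ⬝ᵥ k) → k ≠ 0 → 0 < w ⬝ᵥ k
  finite : ∀ t, {k | (∀ l, 0 ≤ A l ⬝ᵥ k) ∧ w ⬝ᵥ k = t}.Finite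

/-- The point `y` can be moved into the half-open orthant by a small perturbation. -/
def FlagCompatible (T : Finset ι) (s : ι → Bool) (y : ι → ℤ) : Prop :=
  ∀ i ∈ T, if s i then 0 ≤ y i else y i ≤ 0

/-- All entries are nonnegative or all are nonpositive. -/
def SignCoherent (v : ι → ℤ) : Prop := (∀ i, 0 ≤ v i) ∨ ∀ i, v i ≤ 0

lemma exists_pos_of_dotProduct_pos {u v : ι → ℤ} (h : 0 < u ⬝ᵥ v) : ∃ i, 0 < u i * v i := by
  by_contra! hn
  exact absurd h (not_lt.2 (Finset.sum_nonpos fun i _ => hn i))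

/-- If all forms are nonnegative, the cone contains the orthant. If one is nonpositive, it meets the
half-open orthant in nothing. Compatibility of the flags with the interior point `y` settles the
boundary: a coordinate where a form and `y` have the same nonzero sign is strict exactly on the side
where strictness is needed. -/
lemma hasReciprocity_of_signCoherent {A : J → ι → ℤ} {w y : ι → ℤ} {s : ι → Bool}
    (hA : IsGradedCone A w y) (hs : FlagCompatible Finset.univ s y)
    (hcoh : ∀ l, SignCoherent (A l)) : HasReciprocity Finset.univ A w s := by
  classical
  by_cases hpos : ∀ l i, 0 ≤ A l i
  · have hw : ∀ i, 0 < w i := by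
      intro i
      have := hA.degree_pos (Pi.single i 1) (fun l => by simpa using hpos l i) (by simp)
      simpa using this
    have h1 : ∀ t, closedSlice Finset.univ A w s t = orthantSlice w s t := by
      intro t
      ext k
      simp only [closedSlice, orthantSlice, Finset.mem_univ, true_imp_iff, Set.mem_ofPred_eq]
      refine ⟨fun h => ⟨h.1, h.2.2⟩, fun h => ⟨h.1, fun l => ?_, h.2⟩⟩
      exact Finset.sum_nonneg fun i _ =>
        mul_nonneg (hpos l i) ((flagBound_nonneg _).trans (h.1 i))
    have h2 : ∀ t, openSlice Finset.univ A w (fun i => !s i) t =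
        orthantSlice w (fun i => !s i) t := by
      intro t
      ext k
      simp only [openSlice, orthantSlice, Finset.mem_univ, true_imp_iff, Set.mem_ofPred_eq]
      refine ⟨fun h => ⟨h.1, h.2.2⟩, fun h => ⟨h.1, fun l => ?_, h.2⟩⟩
      have h0 : ∀ i, 0 ≤ k i := fun i => (flagBound_nonneg _).trans (h.1 i)
      obtain ⟨i, hi⟩ := exists_pos_of_dotProduct_pos (hA.interior l)
      refine Finset.sum_pos' (fun i _ => mul_nonneg (hpos l i) (h0 i)) ⟨i, Finset.mem_univ i, ?_⟩
      have hAi : 0 < A l i := lt_of_le_of_ne (hpos l i) fun h => by simp [← h] at hi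
      have hyi : 0 < y i := (mul_pos_iff_of_pos_left hAi).1 hi
      have hsi := hs i (Finset.mem_univ i)
      have hki := h.1 i
      cases hb : s i <;> simp only [hb, flagBound] at hsi hki
      · simp at hsi
        omega
      · simp at hki
        exact mul_pos hAi (by omega)
    simpa only [HasReciprocity, h1, h2] using isQuasipoly_orthantSlice w hw s
  · push Not at hpos
    obtain ⟨l, i₀, hl⟩ := hpos
    have hneg : ∀ i, A l i ≤ 0 := (hcoh l).resolve_left fun h => absurd (h i₀) (not_le.2 hl)
    have h1 : ∀ t, closedSlice Finset.univ A w s t = ∅ := by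
      intro t
      refine Set.eq_empty_of_forall_notMem fun k hk => ?_
      have h0 : ∀ i, 0 ≤ k i := fun i => (flagBound_nonneg _).trans (hk.1 i (Finset.mem_univ i))
      obtain ⟨i, hi⟩ := exists_pos_of_dotProduct_pos (hA.interior l)
      have hAi : A l i < 0 := lt_of_le_of_ne (hneg i) fun h => by simp [h] at hi
      have hyi : y i < 0 := by
        by_contra! h
        exact absurd hi (not_lt.2 (mul_nonpos_of_nonpos_of_nonneg hAi.le h))
      have hsi := hs i (Finset.mem_univ i)
      have hki := hk.1 i (Finset.mem_univ i)
      have : 0 < k i := by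
        cases hb : s i <;> simp only [hb, flagBound] at hsi hki
        · simp at hki
          omega
        · simp at hsi
          omega
      have hlt : A l ⬝ᵥ k < 0 := Finset.sum_neg' (fun i _ => mul_nonpos_of_nonpos_of_nonneg
        (hneg i) (h0 i)) ⟨i, Finset.mem_univ i, mul_neg_of_neg_of_pos hAi this⟩
      exact absurd (hk.2.1 l) (not_le.2 hlt)
    have h2 : ∀ t, openSlice Finset.univ A w (fun i => !s i) t = ∅ := by
      intro t
      refine Set.eq_empty_of_forall_notMem fun k hk => ?_
      have h0 : ∀ i, 0 ≤ k i := fun i => (flagBound_nonneg _).trans (hk.1 i (Finset.mem_univ i))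
      exact absurd (hk.2.1 l) (not_lt.2 (Finset.sum_nonpos fun i _ =>
        mul_nonpos_of_nonpos_of_nonneg (hneg i) (h0 i)))
    simp only [HasReciprocity, h1, h2, Set.ncard_empty, Nat.cast_zero, mul_zero, sub_zero]
    exact isQuasipoly_zero _

lemma ncard_eq_add_of_equiv {V : Type*} {X X₁ X₂ : Set V} (e₁ e₂ : V ≃ V) (hX : X.Finite)
    (h : ∀ k, k ∈ X ↔ e₁.symm k ∈ X₁ ∨ e₂.symm k ∈ X₂)
    (hd : ∀ k, e₁.symm k ∈ X₁ → e₂.symm k ∉ X₂) : X.ncard = X₁.ncard + X₂.ncard := by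
  have hun : X = e₁ '' X₁ ∪ e₂ '' X₂ := by
    ext k
    rw [h, Set.mem_union, e₁.image_eq_preimage_symm, e₂.image_eq_preimage_symm]
    rfl
  have hdis : Disjoint (e₁ '' X₁) (e₂ '' X₂) := by
    rw [e₁.image_eq_preimage_symm, e₂.image_eq_preimage_symm, Set.disjoint_left]
    exact hd
  have hfin := hX
  rw [hun] at hfin
  rw [hun, Set.ncard_union_eq hdis (hfin.subset Set.subset_union_left)
    (hfin.subset Set.subset_union_right), Set.ncard_image_of_injective _ e₁.injective,
    Set.ncard_image_of_injective _ e₂.injective]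

lemma IsGradedCone.transform {A : J → ι → ℤ} {w y : ι → ℤ} (hA : IsGradedCone A w y)
    (e : (ι → ℤ) ≃ₗ[ℤ] (ι → ℤ)) (f : (ι → ℤ) → (ι → ℤ)) (hf : ∀ v k, f v ⬝ᵥ k = v ⬝ᵥ e k) :
    IsGradedCone (fun l => f (A l)) (f w) (e.symm y) where
  interior l := by simpa [hf] using hA.interior l
  degree_pos k hk hk0 := by
    simp only [hf] at hk ⊢
    exact hA.degree_pos _ hk (by simpa using hk0)
  finite t := by
    simp only [hf]
    exact (hA.finite t).preimage e.injective.injOn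

/-- Both counts are additive when the closed and the open side are cut disjointly by the same
coordinate changes `e₁`, `e₂`. The maps `f₁`, `f₂` are their transposes, which act on the forms. -/
lemma HasReciprocity.of_split {T T' : Finset ι} {A : J → ι → ℤ} {w y : ι → ℤ}
    {s s₁ s₂ : ι → Bool} (hA : IsGradedCone A w y) (e₁ e₂ : (ι → ℤ) ≃ₗ[ℤ] (ι → ℤ))
    (f₁ f₂ : (ι → ℤ) → (ι → ℤ)) (hf₁ : ∀ v k, f₁ v ⬝ᵥ k = v ⬝ᵥ e₁ k)
    (hf₂ : ∀ v k, f₂ v ⬝ᵥ k = v ⬝ᵥ e₂ k)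
    (hc : ∀ k, (∀ i ∈ T, flagBound (s i) ≤ k i) ↔ (∀ i ∈ T', flagBound (s₁ i) ≤ e₁.symm k i) ∨
      ∀ i ∈ T', flagBound (s₂ i) ≤ e₂.symm k i)
    (hcd : ∀ k, (∀ i ∈ T', flagBound (s₁ i) ≤ e₁.symm k i) →
      ¬ ∀ i ∈ T', flagBound (s₂ i) ≤ e₂.symm k i)
    (ho : ∀ k, (∀ i ∈ T, flagBound (!s i) ≤ k i) ↔
      (∀ i ∈ T', flagBound (!s₁ i) ≤ e₁.symm k i) ∨ ∀ i ∈ T', flagBound (!s₂ i) ≤ e₂.symm k i)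
    (hod : ∀ k, (∀ i ∈ T', flagBound (!s₁ i) ≤ e₁.symm k i) →
      ¬ ∀ i ∈ T', flagBound (!s₂ i) ≤ e₂.symm k i)
    (h₁ : HasReciprocity T' (fun l => f₁ (A l)) (f₁ w) s₁)
    (h₂ : HasReciprocity T' (fun l => f₂ (A l)) (f₂ w) s₂) : HasReciprocity T A w s := by
  have hclosed : ∀ t, (closedSlice T A w s t).ncard =
      (closedSlice T' (fun l => f₁ (A l)) (f₁ w) s₁ t).ncard +
        (closedSlice T' (fun l => f₂ (A l)) (f₂ w) s₂ t).ncard := by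
    intro t
    refine ncard_eq_add_of_equiv e₁.toEquiv e₂.toEquiv ((hA.finite t).subset fun k hk => hk.2) ?_ ?_
    · intro k
      change ((∀ i ∈ T, flagBound (s i) ≤ k i) ∧ (∀ l, 0 ≤ A l ⬝ᵥ k) ∧ w ⬝ᵥ k = t) ↔
        ((∀ i ∈ T', flagBound (s₁ i) ≤ e₁.symm k i) ∧ (∀ l, 0 ≤ f₁ (A l) ⬝ᵥ e₁.symm k) ∧
          f₁ w ⬝ᵥ e₁.symm k = t) ∨
        ((∀ i ∈ T', flagBound (s₂ i) ≤ e₂.symm k i) ∧ (∀ l, 0 ≤ f₂ (A l) ⬝ᵥ e₂.symm k) ∧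
          f₂ w ⬝ᵥ e₂.symm k = t)
      simp only [hf₁, hf₂, LinearEquiv.apply_symm_apply, hc k, or_and_right]
    · intro k hk hk'
      exact hcd k hk.1 hk'.1
  have hopen : ∀ t, (openSlice T A w (fun i => !s i) t).ncard =
      (openSlice T' (fun l => f₁ (A l)) (f₁ w) (fun i => !s₁ i) t).ncard +
        (openSlice T' (fun l => f₂ (A l)) (f₂ w) (fun i => !s₂ i) t).ncard := by
    intro t
    refine ncard_eq_add_of_equiv e₁.toEquiv e₂.toEquiv
      ((hA.finite t).subset fun k hk => ⟨fun l => (hk.2.1 l).le, hk.2.2⟩) ?_ ?_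
    · intro k
      change ((∀ i ∈ T, flagBound (!s i) ≤ k i) ∧ (∀ l, 0 < A l ⬝ᵥ k) ∧ w ⬝ᵥ k = t) ↔
        ((∀ i ∈ T', flagBound (!s₁ i) ≤ e₁.symm k i) ∧ (∀ l, 0 < f₁ (A l) ⬝ᵥ e₁.symm k) ∧
          f₁ w ⬝ᵥ e₁.symm k = t) ∨
        ((∀ i ∈ T', flagBound (!s₂ i) ≤ e₂.symm k i) ∧ (∀ l, 0 < f₂ (A l) ⬝ᵥ e₂.symm k) ∧
          f₂ w ⬝ᵥ e₂.symm k = t)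
      simp only [hf₁, hf₂, LinearEquiv.apply_symm_apply, ho k, or_and_right]
    · intro k hk hk'
      exact hod k hk.1 hk'.1
  unfold HasReciprocity
  convert IsQuasipoly.add h₁ h₂ using 1
  ext t
  simp only [Pi.add_apply, hclosed, hopen]
  push_cast
  ring

end Reciprocity

/-! ### Shears and reflections of the coordinates -/

section CoordinateChanges

variable {ι : Type*} [DecidableEq ι]

/-- The shear that adds the coordinate `j` to the coordinate `i`. -/
def shear (i j : ι) (h : i ≠ j) : (ι → ℤ) ≃ₗ[ℤ] (ι → ℤ) where
  toFun k := k + Pi.single i (k j)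
  invFun k := k - Pi.single i (k j)
  map_add' k k' := by
    simp only [Pi.add_apply, Pi.single_add]
    abel
  map_smul' r k := by
    simp [smul_add, ← Pi.single_smul]
  left_inv k := by simp [Pi.single_eq_of_ne h.symm]
  right_inv k := by simp [Pi.single_eq_of_ne h.symm]

/-- The reflection that changes the sign of the coordinate `i`. -/
def coordNeg (i : ι) : (ι → ℤ) ≃ₗ[ℤ] (ι → ℤ) :=
  LinearEquiv.ofInvolutive
    { toFun := fun k => k - Pi.single i (2 * k i)
      map_add' := fun k k' => by
        simp only [Pi.add_apply, mul_add, Pi.single_add]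
        abel
      map_smul' := fun r k => by
        ext l
        simp only [Pi.smul_apply, Pi.sub_apply, smul_eq_mul, Pi.single_apply, RingHom.id_apply]
        split_ifs <;> ring }
    (fun k => by
      ext l
      simp only [LinearMap.coe_mk, AddHom.coe_mk, Pi.sub_apply, Pi.single_apply]
      split_ifs <;> simp_all
      ring)

lemma shear_dotProduct [Fintype ι] {i j : ι} (h : i ≠ j) (v k : ι → ℤ) :
    shear j i h.symm v ⬝ᵥ k = v ⬝ᵥ shear i j h k := by
  simp [shear, add_dotProduct, dotProduct_add]

lemma coordNeg_apply (i : ι) (k : ι → ℤ) : coordNeg i k = k - Pi.single i (2 * k i) := rfl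

lemma coordNeg_symm (i : ι) : (coordNeg i).symm = coordNeg i := rfl

lemma coordNeg_dotProduct [Fintype ι] (i : ι) (v k : ι → ℤ) : coordNeg i v ⬝ᵥ k = v ⬝ᵥ coordNeg i k := by
  simp only [coordNeg_apply, sub_dotProduct, dotProduct_sub, single_dotProduct, dotProduct_single]
  ring

lemma shear_symm_apply {i j : ι} (h : i ≠ j) (k : ι → ℤ) (l : ι) :
    (shear i j h).symm k l = if l = i then k i - k j else k l := by
  change (k - Pi.single i (k j) : ι → ℤ) l = _
  by_cases hl : l = i
  · subst hl; simp
  · simp [hl]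

lemma shear_apply {i j : ι} (h : i ≠ j) (k : ι → ℤ) (l : ι) :
    shear i j h k l = if l = i then k i + k j else k l := by
  change (k + Pi.single i (k j) : ι → ℤ) l = _
  by_cases hl : l = i
  · subst hl; simp
  · simp [hl]

lemma SignCoherent.shear {v : ι → ℤ} (hv : SignCoherent v) {i j : ι} (h : i ≠ j) :
    SignCoherent (shear i j h v) := by
  refine hv.imp (fun hv l => ?_) fun hv l => ?_ <;>
  · rw [shear_apply]
    have := hv i
    have := hv j
    have := hv l
    split_ifs <;> omega

end CoordinateChanges

/-! ### Elliott's reduction to sign-coherent forms -/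

section Elliott

variable {ι J : Type*} [DecidableEq ι]

/-- Here `x` and `z` are two coordinates of the interior point and `c` says which side owns the wall
`x = z`. If the flags `a`, `b` differ, the sign of `x - z` is constrained so that `c = a` is
admissible; if they agree, the sign of `x - z` decides. This yields the last condition, which
`orthant_split` needs. -/
lemma exists_wall_flag {a b : Bool} {x z : ℤ} (hx : if a then 0 ≤ x else x ≤ 0)
    (hz : if b then 0 ≤ z else z ≤ 0) :
    ∃ c : Bool, (if c then 0 ≤ x - z else x - z ≤ 0) ∧ (if !c then 0 ≤ z - x else z - x ≤ 0) ∧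
      (a = b ∨ a = c) := by
  cases a <;> cases b <;> simp only [if_true, if_false, Bool.false_eq_true] at hx hz
  · rcases le_total x z with h | h
    · exact ⟨false, by simpa using h, by simpa using h, by simp⟩
    · exact ⟨true, by simpa using h, by simpa using h, by simp⟩
  · exact ⟨false, by simp; omega, by simp; omega, by simp⟩
  · exact ⟨true, by simp; omega, by simp; omega, by simp⟩
  · rcases le_total x z with h | h
    · exact ⟨false, by simpa using h, by simpa using h, by simp⟩
    · exact ⟨true, by simpa using h, by simpa using h, by simp⟩

/-- On one side of the wall the bound on `k i` must follow from those on `k j` and `k i - k j`, and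
symmetrically on the other. This is what `hc` ensures; without it the points with `k i = k j = 0`
could be misassigned. -/
lemma orthant_split {i j : ι} (h : i ≠ j) {s : ι → Bool} {c : Bool} (hc : s i = s j ∨ s i = c)
    (k : ι → ℤ) :
    ((∀ l, flagBound (s l) ≤ k l) ↔
      (∀ l, flagBound (Function.update s i c l) ≤ (shear i j h).symm k l) ∨
        ∀ l, flagBound (Function.update s j (!c) l) ≤ (shear j i h.symm).symm k l) ∧
    ((∀ l, flagBound (Function.update s i c l) ≤ (shear i j h).symm k l) →
      ¬ ∀ l, flagBound (Function.update s j (!c) l) ≤ (shear j i h.symm).symm k l) := by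
  have h1 : (∀ l, flagBound (Function.update s i c l) ≤ (shear i j h).symm k l) ↔
      flagBound c ≤ k i - k j ∧ flagBound (s j) ≤ k j ∧
        ∀ l, l ≠ i → l ≠ j → flagBound (s l) ≤ k l := by
    constructor
    · intro H
      refine ⟨by simpa [shear_symm_apply] using H i,
        by simpa [shear_symm_apply, h.symm] using H j, fun l hi _ => ?_⟩
      simpa [shear_symm_apply, hi] using H l
    · rintro ⟨H1, H2, H3⟩ l
      rw [shear_symm_apply]
      by_cases hi : l = i
      · subst hi; simpa using H1
      · by_cases hj : l = j
        · subst hj; simpa [hi] using H2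
        · simpa [hi] using H3 l hi hj
  have h2 : (∀ l, flagBound (Function.update s j (!c) l) ≤ (shear j i h.symm).symm k l) ↔
      flagBound (!c) ≤ k j - k i ∧ flagBound (s i) ≤ k i ∧
        ∀ l, l ≠ i → l ≠ j → flagBound (s l) ≤ k l := by
    constructor
    · intro H
      refine ⟨by simpa [shear_symm_apply] using H j,
        by simpa [shear_symm_apply, h] using H i, fun l _ hj => ?_⟩
      simpa [shear_symm_apply, hj] using H l
    · rintro ⟨H1, H2, H3⟩ l
      rw [shear_symm_apply]
      by_cases hj : l = j
      · subst hj; simpa using H1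
      · by_cases hi : l = i
        · subst hi; simpa [hj] using H2
        · simpa [hj] using H3 l hi hj
  have h3 : (∀ l, flagBound (s l) ≤ k l) ↔ flagBound (s i) ≤ k i ∧ flagBound (s j) ≤ k j ∧
      ∀ l, l ≠ i → l ≠ j → flagBound (s l) ≤ k l := by
    refine ⟨fun H => ⟨H i, H j, fun l _ _ => H l⟩, fun ⟨H1, H2, H3⟩ l => ?_⟩
    by_cases hi : l = i
    · exact hi ▸ H1
    · by_cases hj : l = j
      · exact hj ▸ H2
      · exact H3 l hi hj
  rw [h1, h2, h3]
  generalize (∀ l, l ≠ i → l ≠ j → flagBound (s l) ≤ k l) = R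
  generalize s i = a at *
  generalize s j = b at *
  constructor
  · by_cases hR : R <;> simp only [hR, and_true, and_false, or_false]
    cases a <;> cases b <;> cases c <;> simp [flagBound] at hc ⊢ <;> omega
  · rintro ⟨H, -⟩ ⟨H', -⟩
    cases c <;> simp [flagBound] at H H' <;> omega

variable [Fintype ι]

lemma HasReciprocity.of_shear {A : J → ι → ℤ} {w y : ι → ℤ} {s : ι → Bool}
    (hA : IsGradedCone A w y) (hs : FlagCompatible Finset.univ s y) {i j : ι} (h : i ≠ j) :
    ∃ s₁ s₂ : ι → Bool, FlagCompatible Finset.univ s₁ ((shear i j h).symm y) ∧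
      FlagCompatible Finset.univ s₂ ((shear j i h.symm).symm y) ∧
      (HasReciprocity Finset.univ (fun l => shear j i h.symm (A l)) (shear j i h.symm w) s₁ →
        HasReciprocity Finset.univ (fun l => shear i j h (A l)) (shear i j h w) s₂ →
        HasReciprocity Finset.univ A w s) := by
  obtain ⟨c, hc1, hc2, hc⟩ := exists_wall_flag (hs i (Finset.mem_univ i)) (hs j (Finset.mem_univ j))
  refine ⟨Function.update s i c, Function.update s j (!c), ?_, ?_, fun h₁ h₂ => ?_⟩
  · intro l hl
    rw [shear_symm_apply]
    by_cases hi : l = i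
    · subst hi; simpa using hc1
    · simpa [hi] using hs l hl
  · intro l hl
    rw [shear_symm_apply]
    by_cases hj : l = j
    · subst hj; simpa using hc2
    · simpa [hj] using hs l hl
  · have hn : ∀ (l m : ι) (b : Bool), (!Function.update s l b m) =
        Function.update (fun m => !s m) l (!b) m := by
      intro l m b
      by_cases hm : m = l
      · subst hm; simp
      · simp [hm]
    have hc' : (!s i) = (!s j) ∨ (!s i) = !c := by simpa using hc
    refine HasReciprocity.of_split hA (shear i j h) (shear j i h.symm) (shear j i h.symm)
      (shear i j h) (shear_dotProduct h) (shear_dotProduct h.symm) ?_ ?_ ?_ ?_ h₁ h₂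
    · simpa using fun k => (orthant_split h hc k).1
    · simpa using fun k => (orthant_split h hc k).2
    · simpa only [hn, Finset.mem_univ, true_imp_iff] using fun k => (orthant_split h hc' k).1
    · simpa only [hn, Finset.mem_univ, true_imp_iff] using fun k => (orthant_split h hc' k).2

/-- A free coordinate is cut at `0` into two half-lines with complementary flags, and the negative
one is reflected. The sign of `y i` chooses which of them contains `0`. -/
lemma HasReciprocity.of_insert {T : Finset ι} {A : J → ι → ℤ} {w y : ι → ℤ} {s : ι → Bool}
    (hA : IsGradedCone A w y) (hs : FlagCompatible T s y) {i : ι} (hi : i ∉ T)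
    (H : ∀ (A' : J → ι → ℤ) (w' y' : ι → ℤ) (s' : ι → Bool), IsGradedCone A' w' y' →
      FlagCompatible (insert i T) s' y' → HasReciprocity (insert i T) A' w' s') :
    HasReciprocity T A w s := by
  have hmem : ∀ (r : ι → Bool) (b : Bool) (k : ι → ℤ),
      (∀ l ∈ insert i T, flagBound (Function.update r i b l) ≤ k l) ↔
        flagBound b ≤ k i ∧ ∀ l ∈ T, flagBound (r l) ≤ k l := by
    intro r b k
    rw [Finset.forall_mem_insert, Function.update_self]
    refine and_congr_right fun _ => forall₂_congr fun l hl => ?_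
    rw [Function.update_of_ne (fun h => hi (by rwa [h] at hl))]
  have hneg : ∀ (r : ι → Bool) (b : Bool) (k : ι → ℤ),
      (∀ l ∈ insert i T, flagBound (Function.update r i b l) ≤ coordNeg i k l) ↔
        flagBound b ≤ -k i ∧ ∀ l ∈ T, flagBound (r l) ≤ k l := by
    intro r b k
    rw [hmem, coordNeg_apply]
    refine and_congr (by simp; ring_nf) (forall₂_congr fun l hl => ?_)
    have : l ≠ i := fun h => hi (by rwa [h] at hl)
    simp [this]
  have hn : ∀ (m : ι) (b : Bool), (!Function.update s i b m) =
      Function.update (fun m => !s m) i (!b) m := by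
    intro m b
    by_cases hm : m = i
    · subst hm; simp
    · simp [hm]
  have hcompat : ∀ (b : Bool) (y' : ι → ℤ), (if b then 0 ≤ y' i else y' i ≤ 0) →
      (∀ l ∈ T, y' l = y l) → FlagCompatible (insert i T) (Function.update s i b) y' := by
    intro b y' hb hy' l hl
    rcases Finset.mem_insert.1 hl with rfl | hl
    · simpa using hb
    · rw [Function.update_of_ne (fun h => hi (by rwa [h] at hl)), hy' l hl]
      exact hs l hl
  have hexcl : ∀ (b : Bool) (x : ℤ), (flagBound b ≤ x ∨ flagBound (!b) ≤ -x) ∧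
      (flagBound b ≤ x → ¬ flagBound (!b) ≤ -x) := by
    intro b x
    cases b <;> simp [flagBound] <;> omega
  refine HasReciprocity.of_split (T' := insert i T) (s₁ := Function.update s i (decide (0 ≤ y i)))
    (s₂ := Function.update s i (!decide (0 ≤ y i))) hA (LinearEquiv.refl ℤ _) (coordNeg i) id
    (coordNeg i) (fun _ _ => rfl) (coordNeg_dotProduct i) ?_ ?_ ?_ ?_
    (H _ _ _ _ hA (hcompat _ _ ?_ fun _ _ => rfl))
    (H _ _ _ _ (hA.transform (coordNeg i) _ (coordNeg_dotProduct i)) (hcompat _ _ ?_ ?_))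
  · intro k
    rw [coordNeg_symm, hneg, LinearEquiv.refl_symm, LinearEquiv.refl_apply, hmem, ← or_and_right]
    simp [(hexcl _ _).1]
  · intro k
    rw [coordNeg_symm, hneg, LinearEquiv.refl_symm, LinearEquiv.refl_apply, hmem]
    exact fun h h' => (hexcl _ _).2 h.1 h'.1
  · intro k
    simp only [hn]
    rw [coordNeg_symm, hneg, LinearEquiv.refl_symm, LinearEquiv.refl_apply, hmem, ← or_and_right]
    simp only [(hexcl _ _).1, true_and]
  · intro k
    simp only [hn]
    rw [coordNeg_symm, hneg, LinearEquiv.refl_symm, LinearEquiv.refl_apply, hmem]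
    exact fun h h' => (hexcl _ _).2 h.1 h'.1
  · by_cases hy : 0 ≤ y i
    · simp [hy]
    · simp [hy]; omega
  · rw [coordNeg_symm, coordNeg_apply]
    by_cases hy : 0 ≤ y i
    · simp [hy]; omega
    · simp [hy]; omega
  · intro l hl
    have : l ≠ i := fun h => hi (by rwa [h] at hl)
    rw [coordNeg_symm, coordNeg_apply]
    simp [this]

/-- The reduction of Elliott: a form becomes sign-coherent after finitely many subdivisions, each of
which lowers the number of coordinates where the form is extremal. -/
lemma HasReciprocity.of_extremal_le {P : (J → ι → ℤ) → Prop} (l : J)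
    (hP : ∀ (A : J → ι → ℤ) (i j : ι) (h : i ≠ j), P A → P fun m => shear i j h (A m))
    (H : ∀ (A : J → ι → ℤ) (w y : ι → ℤ) (s : ι → Bool), IsGradedCone A w y →
      FlagCompatible Finset.univ s y → P A → SignCoherent (A l) →
      HasReciprocity Finset.univ A w s) (M n : ℕ) :
    ∀ (a b : ℕ), a + b = M → ∀ (A : J → ι → ℤ) (w y : ι → ℤ) (s : ι → Bool),
      IsGradedCone A w y → FlagCompatible Finset.univ s y → P A →
      (∀ i, -(b : ℤ) ≤ A l i ∧ A l i ≤ a) →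
      (Finset.univ.filter fun i => A l i = a ∨ A l i = -(b : ℤ)).card ≤ n →
      HasReciprocity Finset.univ A w s := by
  induction M generalizing n with
  | zero =>
    intro a b hab A w y s hA hs hPA hb _
    refine H A w y s hA hs hPA (Or.inl fun i => ?_)
    have := (hb i).1
    omega
  | succ M ihM =>
    induction n using Nat.strong_induction_on with
    | _ n ihn =>
    intro a b hab A w y s hA hs hPA hb hn
    rcases Nat.eq_zero_or_pos a with rfl | ha
    · exact H A w y s hA hs hPA (Or.inr fun i => by simpa using (hb i).2)
    rcases Nat.eq_zero_or_pos b with rfl | hb0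
    · exact H A w y s hA hs hPA (Or.inl fun i => by simpa using (hb i).1)
    by_cases hmax : ∃ i, A l i = a
    swap
    · push Not at hmax
      refine ihM (Fintype.card ι) (a - 1) b (by omega) A w y s hA hs hPA (fun i => ?_)
        (Finset.card_le_univ _)
      have := hmax i
      have := hb i
      omega
    by_cases hmin : ∃ i, A l i = -(b : ℤ)
    swap
    · push Not at hmin
      refine ihM (Fintype.card ι) a (b - 1) (by omega) A w y s hA hs hPA (fun i => ?_)
        (Finset.card_le_univ _)
      have := hmin i
      have := hb i
      omega
    obtain ⟨i, hi⟩ := hmax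
    obtain ⟨j, hj⟩ := hmin
    have hij : i ≠ j := by
      rintro rfl
      omega
    -- Adding a minimal entry `-b` to a maximal entry `a` gives `a - b`, which lies strictly between
    -- `-b` and `a` as both are positive. Each half of the cut therefore has one extremal coordinate
    -- less.
    have key : ∀ i' j' : ι, ∀ h : i' ≠ j', (A l i' = a ∨ A l i' = -(b : ℤ)) →
        A l i' + A l j' = a - b → ∀ (w' y' : ι → ℤ) (s' : ι → Bool),
        IsGradedCone (fun m => shear i' j' h (A m)) w' y' → FlagCompatible Finset.univ s' y' →
        HasReciprocity Finset.univ (fun m => shear i' j' h (A m)) w' s' := by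
      intro i' j' h hext hsum w' y' s' hA' hs'
      refine ihn _ ?_ a b hab _ w' y' s' hA' hs' (hP A i' j' h hPA) (fun m => ?_) le_rfl
      · refine lt_of_lt_of_le (Finset.card_lt_card ?_) hn
        refine Finset.ssubset_iff_subset_ne.2 ⟨fun m hm => ?_, fun heq => ?_⟩
        · simp only [Finset.mem_filter, Finset.mem_univ, true_and, shear_apply, hsum] at hm ⊢
          split_ifs at hm
          · omega
          · exact hm
        · have : i' ∈ Finset.univ.filter fun m => A l m = a ∨ A l m = -(b : ℤ) := by simpa using hext
          rw [← heq] at this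
          simp only [Finset.mem_filter, Finset.mem_univ, true_and, shear_apply, hsum, if_true] at this
          omega
      · have := hb m
        simp only [shear_apply, hsum]
        split_ifs <;> omega
    obtain ⟨s₁, s₂, hs₁, hs₂, hsplit⟩ := HasReciprocity.of_shear hA hs hij
    exact hsplit
      (key j i hij.symm (Or.inr hj) (by omega) _ _ s₁
        (hA.transform (shear i j hij) _ (shear_dotProduct hij)) hs₁)
      (key i j hij (Or.inl hi) (by omega) _ _ s₂
        (hA.transform (shear j i hij.symm) _ (shear_dotProduct hij.symm)) hs₂)

/-- The forms are made sign-coherent one after the other; shears preserve the forms that already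
are. `L` holds those not yet treated. -/
lemma hasReciprocity_orthant [Fintype J] {A : J → ι → ℤ} {w y : ι → ℤ} {s : ι → Bool}
    (hA : IsGradedCone A w y) (hs : FlagCompatible Finset.univ s y) :
    HasReciprocity Finset.univ A w s := by
  classical
  have main : ∀ (L : Finset J) (A : J → ι → ℤ) (w y : ι → ℤ) (s : ι → Bool), IsGradedCone A w y →
      FlagCompatible Finset.univ s y → (∀ l, l ∉ L → SignCoherent (A l)) →
      HasReciprocity Finset.univ A w s := by
    intro L
    induction L using Finset.induction_on with
    | empty =>
      intro A w y s hA hs hcoh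
      exact hasReciprocity_of_signCoherent hA hs fun l => hcoh l (Finset.notMem_empty l)
    | insert l L _ ih =>
      intro A w y s hA hs hcoh
      have hbound : ∀ i, |A l i| ≤ ((∑ i, (A l i).natAbs : ℕ) : ℤ) := by
        intro i
        rw [Int.abs_eq_natAbs]
        exact_mod_cast Finset.single_le_sum (f := fun i => (A l i).natAbs) (fun _ _ => Nat.zero_le _)
          (Finset.mem_univ i)
      refine HasReciprocity.of_extremal_le
        (P := fun A => ∀ m, m ∉ insert l L → SignCoherent (A m)) l
        (fun A i j h hP m hm => (hP m hm).shear h)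
        (fun A w y s hA hs hP hl => ih A w y s hA hs fun m hm => ?_) _ _ _ _ rfl A w y s hA hs hcoh
        (fun i => abs_le.1 (hbound i)) le_rfl
      by_cases hml : m = l
      · exact hml ▸ hl
      · exact hP m (by simp [hml, hm])
  exact main Finset.univ A w y s hA hs fun l hl => absurd (Finset.mem_univ l) hl

/-- Ehrhart reciprocity for a graded cone with an interior integral point. -/
theorem IsGradedCone.isQuasipoly [Fintype J] {A : J → ι → ℤ} {w y : ι → ℤ}
    (hA : IsGradedCone A w y) :
    IsQuasipoly (Fintype.card ι) fun t =>
      ({k : ι → ℤ | (∀ l, 0 ≤ A l ⬝ᵥ k) ∧ w ⬝ᵥ k = t}.ncard : ℚ) -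
      (-1) ^ Fintype.card ι * ({k : ι → ℤ | (∀ l, 0 < A l ⬝ᵥ k) ∧ w ⬝ᵥ k = -t}.ncard : ℚ) := by
  classical
  -- `T` is the set of coordinates without a sign condition, so the induction starts with full
  -- orthants and ends with the whole space.
  have main : ∀ (T : Finset ι) (A : J → ι → ℤ) (w y : ι → ℤ) (s : ι → Bool), IsGradedCone A w y →
      FlagCompatible Tᶜ s y → HasReciprocity Tᶜ A w s := by
    intro T
    induction T using Finset.induction_on with
    | empty =>
      intro A w y s hA hs
      rw [Finset.compl_empty] at hs ⊢
      exact hasReciprocity_orthant hA hs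
    | insert i T hi ih =>
      intro A w y s hA hs
      refine HasReciprocity.of_insert hA hs (i := i) (by simp) ?_
      have : insert i (insert i T)ᶜ = Tᶜ := by
        ext m
        by_cases hm : m = i
        · subst hm; simp [hi]
        · simp [hm]
      rw [this]
      exact ih
  have := main Finset.univ A w y (fun _ => true) hA (by simp [FlagCompatible])
  simpa [HasReciprocity, closedSlice, openSlice] using this

end Elliott

/-! ### Lattice points in open and closed cubes -/

section LatticePoints

variable {σ : Type*}

/-- The number of points of the lattice `L` in the open cube with edge length `t`. -/
noncomputable def openCount (L : Submodule ℤ (σ → ℤ)) (t : ℤ) : ℕ :=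
  {z : σ → ℤ | z ∈ L ∧ ∀ i, 0 < z i ∧ z i < t}.ncard

lemma openBox_finite [Fintype σ] (L : Submodule ℤ (σ → ℤ)) (t : ℤ) :
    {z : σ → ℤ | z ∈ L ∧ ∀ i, 0 < z i ∧ z i < t}.Finite :=
  (Set.Finite.pi' fun _ : σ => Set.finite_Ioo (0 : ℤ) t).subset fun _ hz i => hz.2 i

lemma openCount_mono [Fintype σ] (L : Submodule ℤ (σ → ℤ)) : Monotone (openCount L) := fun _ t' h =>
  Set.ncard_le_ncard (fun _ hz => ⟨hz.1, fun i => ⟨(hz.2 i).1, (hz.2 i).2.trans_le h⟩⟩)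
    (openBox_finite L t')

lemma openCount_eq_zero [Nonempty σ] (L : Submodule ℤ (σ → ℤ)) {t : ℤ} (ht : t ≤ 1) :
    openCount L t = 0 := by
  have : {z : σ → ℤ | z ∈ L ∧ ∀ i, 0 < z i ∧ z i < t} = ∅ := by
    refine Set.eq_empty_of_forall_notMem fun z hz => ?_
    have := hz.2 (Classical.arbitrary σ)
    omega
  rw [openCount, this, Set.ncard_empty]

lemma ncard_closedBox {L : Submodule ℤ (σ → ℤ)} (h1 : (fun _ => 1) ∈ L) (t : ℤ) :
    {z : σ → ℤ | z ∈ L ∧ ∀ i, 0 ≤ z i ∧ z i ≤ t}.ncard = openCount L (t + 2) := by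
  have : {z : σ → ℤ | z ∈ L ∧ ∀ i, 0 < z i ∧ z i < t + 2} =
      (fun z => z + fun _ => 1) '' {z : σ → ℤ | z ∈ L ∧ ∀ i, 0 ≤ z i ∧ z i ≤ t} := by
    ext z
    constructor
    · rintro ⟨hz, hb⟩
      refine ⟨z - fun _ => 1, ⟨L.sub_mem hz h1, fun i => ?_⟩, by simp⟩
      have := hb i
      simp only [Pi.sub_apply]
      omega
    · rintro ⟨z, ⟨hz, hb⟩, rfl⟩
      refine ⟨L.add_mem hz h1, fun i => ?_⟩
      have := hb i
      simp only [Pi.add_apply]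
      omega
  rw [openCount, this, Set.ncard_image_of_injective _ (add_left_injective _)]

/-- The point with the coordinates `k` in the basis `b`. -/
noncomputable def latticePoint {β : Type*} [Fintype β] {L : Submodule ℤ (σ → ℤ)} (b : Module.Basis β ℤ L)
    (k : β → ℤ) : σ → ℤ := (b.equivFun.symm k : L)

section

variable {β : Type*} [Fintype β] {L : Submodule ℤ (σ → ℤ)} (b : Module.Basis β ℤ L)

lemma latticePoint_mem (k : β → ℤ) : latticePoint b k ∈ L := (b.equivFun.symm k).2

lemma latticePoint_injective : Function.Injective (latticePoint b) :=
  Subtype.val_injective.comp b.equivFun.symm.injective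

lemma exists_latticePoint {z : σ → ℤ} (hz : z ∈ L) : ∃ k, latticePoint b k = z :=
  ⟨b.equivFun ⟨z, hz⟩, by simp [latticePoint]⟩

lemma latticePoint_apply (k : β → ℤ) (i : σ) :
    latticePoint b k i = ∑ l, k l * (b l : σ → ℤ) i := by
  simp [latticePoint, Module.Basis.equivFun_symm_apply]

/-- The forms `z i` and `t - z i` in the coordinates of `(z, t)`. -/
noncomputable def boxForms : σ ⊕ σ → β ⊕ Unit → ℤ
  | .inl i => Sum.elim (fun l => (b l : σ → ℤ) i) 0
  | .inr i => Sum.elim (fun l => -(b l : σ → ℤ) i) 1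

/-- The form `t` in the coordinates of `(z, t)`. -/
def heightForm (β : Type*) : β ⊕ Unit → ℤ := Sum.elim 0 1

lemma heightForm_dotProduct (k : β ⊕ Unit → ℤ) : heightForm β ⬝ᵥ k = k (Sum.inr ()) := by
  simp [heightForm, dotProduct]

lemma boxForms_inl_dotProduct (i : σ) (k : β ⊕ Unit → ℤ) :
    boxForms b (.inl i) ⬝ᵥ k = latticePoint b (k ∘ Sum.inl) i := by
  simp [boxForms, dotProduct, latticePoint_apply, mul_comm]

lemma boxForms_inr_dotProduct (i : σ) (k : β ⊕ Unit → ℤ) :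
    boxForms b (.inr i) ⬝ᵥ k = k (Sum.inr ()) - latticePoint b (k ∘ Sum.inl) i := by
  simp [boxForms, dotProduct, latticePoint_apply, mul_comm]
  ring

lemma latticePoint_comp_inl_injOn {X : Set (β ⊕ Unit → ℤ)} {t : ℤ}
    (hX : ∀ k ∈ X, k (Sum.inr ()) = t) : X.InjOn fun k => latticePoint b (k ∘ Sum.inl) := by
  intro k hk k' hk' h
  have := latticePoint_injective b h
  ext (l | l)
  · exact congrFun this l
  · exact (hX k hk).trans (hX k' hk').symm

lemma image_closedCone (t : ℤ) : (fun k => latticePoint b (k ∘ Sum.inl)) ''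
    {k | (∀ l, 0 ≤ boxForms b l ⬝ᵥ k) ∧ heightForm β ⬝ᵥ k = t} =
      {z : σ → ℤ | z ∈ L ∧ ∀ i, 0 ≤ z i ∧ z i ≤ t} := by
  ext z
  simp only [Sum.forall, boxForms_inl_dotProduct, boxForms_inr_dotProduct, heightForm_dotProduct]
  constructor
  · rintro ⟨k, ⟨⟨h1, h2⟩, rfl⟩, rfl⟩
    exact ⟨latticePoint_mem b _, fun i => ⟨h1 i, by linarith [h2 i]⟩⟩
  · rintro ⟨hz, hb⟩
    obtain ⟨k, rfl⟩ := exists_latticePoint b hz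
    exact ⟨Sum.elim k fun _ => t, ⟨⟨fun i => by simpa using (hb i).1,
      fun i => by simpa using (hb i).2⟩, rfl⟩, by simp⟩

lemma image_openCone (t : ℤ) : (fun k => latticePoint b (k ∘ Sum.inl)) ''
    {k | (∀ l, 0 < boxForms b l ⬝ᵥ k) ∧ heightForm β ⬝ᵥ k = t} =
      {z : σ → ℤ | z ∈ L ∧ ∀ i, 0 < z i ∧ z i < t} := by
  ext z
  simp only [Sum.forall, boxForms_inl_dotProduct, boxForms_inr_dotProduct, heightForm_dotProduct]
  constructor
  · rintro ⟨k, ⟨⟨h1, h2⟩, rfl⟩, rfl⟩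
    exact ⟨latticePoint_mem b _, fun i => ⟨h1 i, by linarith [h2 i]⟩⟩
  · rintro ⟨hz, hb⟩
    obtain ⟨k, rfl⟩ := exists_latticePoint b hz
    exact ⟨Sum.elim k fun _ => t, ⟨⟨fun i => by simpa using (hb i).1,
      fun i => by simpa using (hb i).2⟩, rfl⟩, by simp⟩

/-- The cone over the cube has the interior point `(1, …, 1)` at height `2`. A coordinate must
exist, since otherwise nothing forces the height to be nonnegative. -/
lemma isGradedCone_box [Fintype σ] [Nonempty σ] (h1 : (fun _ => 1) ∈ L) :
    ∃ y, IsGradedCone (boxForms b) (heightForm β) y := by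
  obtain ⟨k₁, hk₁⟩ := exists_latticePoint b h1
  refine ⟨Sum.elim k₁ fun _ => 2, ⟨?_, ?_, ?_⟩⟩
  · simp [Sum.forall, boxForms_inl_dotProduct, boxForms_inr_dotProduct, hk₁]
  · intro k hk hk0
    simp only [Sum.forall, boxForms_inl_dotProduct, boxForms_inr_dotProduct] at hk
    rw [heightForm_dotProduct]
    have hle : ∀ i, latticePoint b (k ∘ Sum.inl) i ≤ k (Sum.inr ()) := fun i => by
      linarith [hk.2 i]
    refine lt_of_le_of_ne ((hk.1 _).trans (hle (Classical.arbitrary σ))) fun h => hk0 ?_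
    have hz : latticePoint b (k ∘ Sum.inl) = latticePoint b 0 := by
      ext i
      have : latticePoint b 0 i = 0 := by simp [latticePoint_apply]
      linarith [hk.1 i, hle i]
    ext (l | l)
    · exact congrFun (latticePoint_injective b hz) l
    · exact h.symm
  · intro t
    refine Set.Finite.of_finite_image ?_ (latticePoint_comp_inl_injOn b (t := t) fun k hk => ?_)
    · rw [image_closedCone]
      exact (Set.Finite.pi' fun _ : σ => Set.finite_Icc (0 : ℤ) t).subset fun _ hz i => hz.2 i
    · rw [← hk.2, heightForm_dotProduct]

end

/-- The counting function of a lattice in open cubes extends to a quasipolynomial with parity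
symmetry. -/
theorem exists_isQuasipoly_openCount [Fintype σ] [Nonempty σ] {L : Submodule ℤ (σ → ℤ)}
    (h1 : (fun _ => 1) ∈ L) :
    ∃ h : ℤ → ℚ, IsQuasipoly (Module.finrank ℤ L + 1) h ∧
      (∀ n, h (-n) = (-1) ^ Module.finrank ℤ L * h n) ∧
      ∀ n : ℕ, h n = openCount L (n + 1) := by
  set d := Module.finrank ℤ L
  let b : Module.Basis (Fin d) ℤ L := Module.finBasis ℤ L
  obtain ⟨y, hy⟩ := isGradedCone_box b h1
  have hq := hy.isQuasipoly
  have hclosed : ∀ t, {k | (∀ l, 0 ≤ boxForms b l ⬝ᵥ k) ∧ heightForm (Fin d) ⬝ᵥ k = t}.ncard =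
      openCount L (t + 2) := by
    intro t
    rw [← ncard_closedBox h1, ← image_closedCone b, (latticePoint_comp_inl_injOn b (t := t)
      fun k hk => by rw [← hk.2, heightForm_dotProduct]).ncard_image]
  have hopen : ∀ t, {k | (∀ l, 0 < boxForms b l ⬝ᵥ k) ∧ heightForm (Fin d) ⬝ᵥ k = t}.ncard =
      openCount L t := by
    intro t
    rw [openCount, ← image_openCone b, (latticePoint_comp_inl_injOn b (t := t)
      fun k hk => by rw [← hk.2, heightForm_dotProduct]).ncard_image]
  simp only [hclosed, hopen, Fintype.card_sum, Fintype.card_fin, Fintype.card_unit] at hq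
  have hsq : ((-1 : ℚ) ^ d) * (-1) ^ d = 1 := by rw [← mul_pow]; simp
  -- The shift turns the expression into `openCount L (n + 1) + (-1) ^ d * openCount L (1 - n)`,
  -- visibly symmetric under `n ↦ -n` up to the sign. For `n ≥ 0` the second term vanishes.
  refine ⟨_, hq.comp_add (-1), fun n => ?_, fun n => ?_⟩
  · have e1 : -n + -1 + 2 = 1 - n := by ring
    have e2 : n + -1 + 2 = n + 1 := by ring
    have e3 : -(-n + -1) = n + 1 := by ring
    have e4 : -(n + -1) = 1 - n := by ring
    rw [e1, e2, e3, e4, pow_succ]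
    linear_combination -(openCount L (1 - n) : ℚ) * hsq
  · have e1 : (n : ℤ) + -1 + 2 = n + 1 := by ring
    rw [e1, openCount_eq_zero L (t := -((n : ℤ) + -1)) (by omega)]
    simp

/-- The counting function of a lattice grows at least like a power of the edge length. -/
theorem exists_pow_le_openCount [Fintype σ] {L : Submodule ℤ (σ → ℤ)} (h1 : (fun _ => 1) ∈ L) :
    ∃ B : ℕ, 0 < B ∧ ∀ m : ℕ, m ^ Module.finrank ℤ L ≤ openCount L (2 * B * m + 2) := by
  set d := Module.finrank ℤ L
  let b : Module.Basis (Fin d) ℤ L := Module.finBasis ℤ L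
  set B₀ : ℕ := ∑ i, ∑ l, ((b l : σ → ℤ) i).natAbs
  refine ⟨B₀ + 1, Nat.succ_pos _, fun m => ?_⟩
  -- Combinations of the basis with coefficients in `[0, m)` have coordinates of absolute value at
  -- most `B₀ * m`; translation by `c` in the all-ones direction moves them into the open cube.
  set c : ℤ := (B₀ + 1) * m + 1
  let Ψ : (Fin d → Fin m) → σ → ℤ := fun k => latticePoint b (fun l => (k l : ℤ)) + fun _ => c
  have hΨ : Function.Injective Ψ := by
    intro k k' h
    have := latticePoint_injective b (add_right_cancel h)
    ext l
    exact_mod_cast congrFun this l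
  have hmem : Set.range Ψ ⊆ {z : σ → ℤ | z ∈ L ∧ ∀ i, 0 < z i ∧
      z i < 2 * ((B₀ + 1 : ℕ) : ℤ) * m + 2} := by
    rintro _ ⟨k, rfl⟩
    refine ⟨L.add_mem (latticePoint_mem b _) ?_, fun i => ?_⟩
    · have := L.smul_mem c h1
      simpa [Pi.smul_def] using this
    · have habs : |latticePoint b (fun l => (k l : ℤ)) i| ≤ B₀ * m := by
        rw [latticePoint_apply]
        calc |∑ l, (k l : ℤ) * (b l : σ → ℤ) i| ≤ ∑ l, |(k l : ℤ) * (b l : σ → ℤ) i| :=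
              Finset.abs_sum_le_sum_abs _ _
          _ ≤ ∑ l, (((b l : σ → ℤ) i).natAbs : ℤ) * m := by
              refine Finset.sum_le_sum fun l _ => ?_
              rw [abs_mul, mul_comm, Int.abs_eq_natAbs]
              refine mul_le_mul_of_nonneg_left ?_ (by positivity)
              rw [abs_of_nonneg (by positivity)]
              exact_mod_cast (k l).2.le
          _ = ((∑ l, ((b l : σ → ℤ) i).natAbs : ℕ) : ℤ) * m := by
              rw [← Finset.sum_mul]; push_cast; rfl
          _ ≤ B₀ * m := by
              refine mul_le_mul_of_nonneg_right ?_ (by positivity)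
              exact_mod_cast Finset.single_le_sum
                (f := fun i => ∑ l, ((b l : σ → ℤ) i).natAbs) (fun _ _ => Nat.zero_le _)
                (Finset.mem_univ i)
      have h2 := abs_le.1 habs
      have hm : (0 : ℤ) ≤ m := by positivity
      simp only [Ψ, Pi.add_apply, c]
      push_cast
      constructor <;> linarith
  calc m ^ d = Nat.card (Fin d → Fin m) := by simp
    _ = (Set.range Ψ).ncard := by
        rw [← Set.image_univ, Set.ncard_image_of_injective _ hΨ, Set.ncard_univ]
    _ ≤ _ := Set.ncard_le_ncard hmem (openBox_finite L _)

end LatticePoints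

/-! ### Real and integral solutions of integral equations -/

section RationalSubspaces

variable {σ : Type*} [Fintype σ]

/-- The vectors over `R` that are orthogonal to all the integral vectors in `C`. -/
def orthogonalSubmodule (R : Type*) [CommRing R] (C : Set (σ → ℤ)) : Submodule R (σ → R) where
  carrier := {z | ∀ c ∈ C, ∑ i, (c i : R) * z i = 0}
  zero_mem' := by simp
  add_mem' := by
    intro a b ha hb c hc
    simp only [Pi.add_apply, mul_add, Finset.sum_add_distrib, ha c hc, hb c hc, add_zero]
  smul_mem' := by
    intro r a ha c hc
    simp only [Pi.smul_apply, smul_eq_mul, mul_left_comm _ r, ← Finset.mul_sum, ha c hc, mul_zero]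

/-- Inclusion of the integral vectors into the rational or real ones. -/
def intCastVec (R : Type*) [CommRing R] (σ : Type*) : (σ → ℤ) →ₗ[ℤ] (σ → R) where
  toFun z i := z i
  map_add' z z' := by ext; simp
  map_smul' r z := by ext; simp

variable (C : Set (σ → ℤ))

lemma exists_smul_int_mem {z : σ → ℚ} (hz : z ∈ orthogonalSubmodule ℚ C) :
    ∃ m : ℤ, m ≠ 0 ∧ ∃ x ∈ orthogonalSubmodule ℤ C, intCastVec ℚ σ x = (m : ℚ) • z := by
  obtain ⟨m, hm⟩ := IsLocalization.exist_integer_multiples_of_finite (nonZeroDivisors ℤ) z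
  choose x hx using hm
  have hm0 : (m : ℤ) ≠ 0 := nonZeroDivisors.coe_ne_zero m
  have hxz : intCastVec ℚ σ x = ((m : ℤ) : ℚ) • z := by
    ext i
    have := hx i
    simpa [intCastVec, Algebra.smul_def] using this
  refine ⟨m, hm0, x, fun c hc => ?_, hxz⟩
  have h1 : (∑ i, (c i : ℚ) * intCastVec ℚ σ x i) = 0 := by
    rw [hxz]
    simp only [Pi.smul_apply, smul_eq_mul, mul_left_comm _ ((m : ℤ) : ℚ), ← Finset.mul_sum, hz c hc,
      mul_zero]
  have h2 : ((∑ i, c i * x i : ℤ) : ℚ) = 0 := by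
    push_cast
    exact h1
  exact_mod_cast h2

/-- Expand the coordinates of a real solution in a basis of `ℝ` over `ℚ`. Since the equations are
rational, each component vector is a rational solution, and clearing denominators makes it integral.
-/
lemma span_range_intCastVec :
    Submodule.span ℝ (intCastVec ℝ σ '' (orthogonalSubmodule ℤ C : Set (σ → ℤ))) =
      orthogonalSubmodule ℝ C := by
  apply le_antisymm
  · rw [Submodule.span_le]
    rintro _ ⟨x, hx, rfl⟩ c hc
    have := hx c hc
    simp only [intCastVec, LinearMap.coe_mk, AddHom.coe_mk]
    exact_mod_cast this
  · intro v hv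
    let β := Module.Basis.ofVectorSpace ℚ ℝ
    have hmem : ∀ k, (fun i => β.repr (v i) k) ∈ orthogonalSubmodule ℚ C := by
      intro k c hc
      have h := congrArg (fun r => β.repr r k) (hv c hc)
      simp only [map_sum, map_zero, Finsupp.coe_zero, Pi.zero_apply, Finsupp.coe_finsetSum,
        Finset.sum_apply] at h
      rw [← h]
      refine Finset.sum_congr rfl fun i _ => ?_
      have : (c i : ℝ) * v i = (c i : ℚ) • v i := by rw [Rat.smul_def]; simp
      rw [this, map_smul]
      simp
    have hspan : ∀ k, (fun i => ((β.repr (v i) k : ℚ) : ℝ)) ∈ Submodule.span ℝ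
        (intCastVec ℝ σ '' (orthogonalSubmodule ℤ C : Set (σ → ℤ))) := by
      intro k
      obtain ⟨m, hm, x, hx, hxz⟩ := exists_smul_int_mem C (hmem k)
      have : (fun i => ((β.repr (v i) k : ℚ) : ℝ)) = ((m : ℝ)⁻¹) • intCastVec ℝ σ x := by
        ext i
        have h := congrFun hxz i
        simp only [intCastVec, LinearMap.coe_mk, AddHom.coe_mk, Pi.smul_apply, smul_eq_mul] at h ⊢
        have h' : (x i : ℝ) = (m : ℝ) * (β.repr (v i) k : ℚ) := by exact_mod_cast h
        have hm' : (m : ℝ) ≠ 0 := by exact_mod_cast hm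
        rw [h']
        field_simp
      rw [this]
      exact Submodule.smul_mem _ _ (Submodule.subset_span ⟨x, hx, rfl⟩)
    classical
    have hsum : v = ∑ k ∈ Finset.univ.biUnion fun i => (β.repr (v i)).support,
        (β k : ℝ) • fun i => ((β.repr (v i) k : ℚ) : ℝ) := by
      ext i
      conv_lhs => rw [← β.linearCombination_repr (v i)]
      rw [Finsupp.linearCombination_apply, Finsupp.sum_of_support_subset _
        (Finset.subset_biUnion_of_mem (fun i => (β.repr (v i)).support) (Finset.mem_univ i)) _
        (by simp), Finset.sum_apply]
      refine Finset.sum_congr rfl fun k _ => ?_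
      rw [Rat.smul_def, Pi.smul_apply, smul_eq_mul, mul_comm]
    rw [hsum]
    exact Submodule.sum_mem _ fun k _ => Submodule.smul_mem _ _ (hspan k)

lemma linearIndependent_intCastVec {β : Type*} {b : β → σ → ℤ} (hb : LinearIndependent ℤ b) :
    LinearIndependent ℝ fun l => intCastVec ℝ σ (b l) := by
  have h : (fun l => intCastVec ℝ σ (b l)) = fun l => algebraMap ℤ ℝ ∘ b l := by
    ext
    simp [intCastVec]
  rw [h]
  exact linearIndependent_algebraMap_comp_iff.2 hb

theorem finrank_orthogonalSubmodule :
    Module.finrank ℝ (orthogonalSubmodule ℝ C) = Module.finrank ℤ (orthogonalSubmodule ℤ C) := by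
  let b := Module.finBasis ℤ (orthogonalSubmodule ℤ C)
  have hli : LinearIndependent ℝ fun l => intCastVec ℝ σ (b l) :=
    linearIndependent_intCastVec (b.linearIndependent.map' (Submodule.subtype _) (by simp))
  have hspan : Submodule.span ℝ (Set.range fun l => intCastVec ℝ σ (b l)) =
      orthogonalSubmodule ℝ C := by
    rw [← span_range_intCastVec]
    apply le_antisymm
    · refine Submodule.span_mono ?_
      rintro _ ⟨l, rfl⟩
      exact ⟨b l, (b l).2, rfl⟩
    · rw [Submodule.span_le]
      rintro _ ⟨x, hx, rfl⟩
      have h : x = ((∑ l, b.repr ⟨x, hx⟩ l • b l : orthogonalSubmodule ℤ C) : σ → ℤ) := by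
        rw [b.sum_repr]
      rw [h]
      simp only [SetLike.mem_coe, Submodule.coe_sum, Submodule.coe_smul, map_sum, map_smul]
      refine Submodule.sum_mem _ fun l _ => ?_
      rw [← Int.cast_smul_eq_zsmul ℝ]
      exact Submodule.smul_mem _ _ (Submodule.subset_span ⟨l, rfl⟩)
  rw [← hspan, finrank_span_eq_card hli, Fintype.card_fin]

end RationalSubspaces

/-! ### Move equations as integral coefficient vectors -/

section MoveEquations

variable {I : Type} [DecidableEq I]

/-- The coefficients of the equation of `moveHyperplane i j m`; the first coordinates of the pieces
are indexed by `inl` and the second ones by `inr`. -/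
def moveVector (i j : I) (m : ℤ × ℤ) : I ⊕ I → ℤ :=
  Sum.elim (fun a => (Pi.single j 1 - Pi.single i 1 : I → ℤ) a * m.2)
    fun a => (Pi.single j 1 - Pi.single i 1 : I → ℤ) a * -m.1

lemma sum_moveVector [Fintype I] {R : Type*} [CommRing R] (i j : I) (m : ℤ × ℤ) (z : I ⊕ I → R) :
    ∑ x, (moveVector i j m x : R) * z x =
      (z (.inl j) - z (.inl i)) * m.2 + (z (.inr j) - z (.inr i)) * -m.1 := by
  have h : ∀ (x : I → R) (r : R),
      ∑ a, ((Pi.single j 1 - Pi.single i 1 : I → R) a * r) * x a = (x j - x i) * r := by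
    intro x r
    simp only [Pi.sub_apply, Pi.single_apply, sub_mul, ite_mul, one_mul, zero_mul,
      Finset.sum_sub_distrib, Finset.sum_ite_eq', Finset.mem_univ, if_true]
    ring
  rw [Fintype.sum_sum_type, ← h (fun a => z (.inl a)), ← h (fun a => z (.inr a))]
  congr 1 <;>
  · refine Finset.sum_congr rfl fun a _ => ?_
    simp [moveVector, Pi.single_apply]

/-- The identification of `(R²)^κ` with `R^(2κ)`. -/
def pairEquiv (R I : Type*) [CommRing R] : (I → R × R) ≃ₗ[R] (I ⊕ I → R) where
  toFun z := Sum.elim (fun i => (z i).1) fun i => (z i).2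
  invFun x i := (x (.inl i), x (.inr i))
  map_add' z z' := by ext (i | i) <;> simp
  map_smul' r z := by ext (i | i) <;> simp
  left_inv z := by ext i <;> simp
  right_inv x := by ext (i | i) <;> simp

end MoveEquations

/-! ### The lattice of the essential part: its rank and its count `α` -/

section EssentialPart

variable {q : ℕ} (E : Set (Fin q × Fin q × (ℤ × ℤ)))

/-- The coefficient vectors of the equations `E`. -/
def equationVectors : Set (involvedPieces E ⊕ involvedPieces E → ℤ) :=
  {c | ∃ (i j : involvedPieces E) (m : ℤ × ℤ), ((i : Fin q), (j : Fin q), m) ∈ E ∧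
    c = moveVector i j m}

lemma essentialPart_eq_comap [Fintype (involvedPieces E)] :
    essentialPart E = (orthogonalSubmodule ℝ (equationVectors E)).comap
      (pairEquiv ℝ (involvedPieces E)).toLinearMap := by
  ext z
  have h : z ∈ essentialPart E ↔ ∀ (i j : involvedPieces E) (m : ℤ × ℤ),
      ((i : Fin q), (j : Fin q), m) ∈ E → z ∈ moveHyperplane i j m := by
    simp [essentialPart, Submodule.mem_iInf]
  rw [h, Submodule.mem_comap]
  constructor
  · rintro H _ ⟨i, j, m, hE, rfl⟩
    rw [sum_moveVector]
    exact H i j m hE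
  · intro H i j m hE
    have := H _ ⟨i, j, m, hE, rfl⟩
    rw [sum_moveVector] at this
    exact this

lemma attackSubspace_eq_comap : attackSubspace E =
    (essentialPart E).comap (LinearMap.funLeft ℝ (ℝ × ℝ) ((↑) : involvedPieces E → Fin q)) := by
  ext z
  simp only [attackSubspace, essentialPart, Submodule.mem_comap, Submodule.mem_iInf]
  constructor
  · exact fun H i j m hE => H _ hE
  · rintro H ⟨i, j, m⟩ hE
    exact H ⟨i, _, hE, Or.inl rfl⟩ ⟨j, _, hE, Or.inr rfl⟩ m hE

/-- `attackSubspace E` is the preimage of `essentialPart E` under the surjective restriction to the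
involved pieces, so the codimensions agree. -/
lemma finrank_add_codim [Fintype (involvedPieces E)] :
    Module.finrank ℤ (orthogonalSubmodule ℤ (equationVectors E)) + codim (attackSubspace E) =
      2 * (involvedPieces E).ncard := by
  have h1 : codim (attackSubspace E) = codim (essentialPart E) := by
    let ρ := LinearMap.funLeft ℝ (ℝ × ℝ) ((↑) : involvedPieces E → Fin q)
    have hρ : Function.Surjective ((essentialPart E).mkQ ∘ₗ ρ) :=
      (Submodule.mkQ_surjective _).comp
        (LinearMap.funLeft_surjective_of_injective _ _ _ Subtype.val_injective)
    have hker : attackSubspace E = LinearMap.ker ((essentialPart E).mkQ ∘ₗ ρ) := by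
      rw [LinearMap.ker_comp, Submodule.ker_mkQ, attackSubspace_eq_comap]
    rw [codim, hker]
    exact (LinearMap.quotKerEquivOfSurjective _ hρ).finrank_eq
  have h2 : Module.finrank ℝ (essentialPart E) =
      Module.finrank ℝ (orthogonalSubmodule ℝ (equationVectors E)) := by
    rw [essentialPart_eq_comap]
    exact (LinearEquiv.ofSubmodule' (pairEquiv ℝ (involvedPieces E)) _).finrank_eq
  rw [← finrank_orthogonalSubmodule, ← h2, h1, codim, add_comm,
    Submodule.finrank_quotient_add_finrank, (pairEquiv ℝ (involvedPieces E)).finrank_eq,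
    Module.finrank_fintype_fun_eq_card, Fintype.card_sum, ← Nat.card_coe_set_eq,
    Nat.card_eq_fintype_card, two_mul]

lemma one_mem_orthogonalSubmodule [Fintype (involvedPieces E)] :
    (fun _ => 1) ∈ orthogonalSubmodule ℤ (equationVectors E) := by
  rintro _ ⟨i, j, m, hE, rfl⟩
  have := sum_moveVector (R := ℤ) i j m fun _ => 1
  simpa using this

lemma alpha_eq_openCount [Fintype (involvedPieces E)] (n : ℕ) :
    alpha E n = openCount (orthogonalSubmodule ℤ (equationVectors E)) (n + 1) := by
  have hpos : (0 : ℝ) < ((n + 1 : ℕ) : ℝ) := by positivity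
  have himage : {x | x ∈ orthogonalSubmodule ℤ (equationVectors E) ∧
      ∀ i, 0 < x i ∧ x i < (n : ℤ) + 1} = pairEquiv ℤ (involvedPieces E) ''
      {z | (fun i => (((z i).1 : ℝ), ((z i).2 : ℝ))) ∈ ((n + 1 : ℕ) : ℝ) •
        (openCube (involvedPieces E) ∩ (essentialPart E : Set (involvedPieces E → ℝ × ℝ)))} := by
    rw [← LinearEquiv.coe_toEquiv, Equiv.image_eq_preimage_symm]
    ext x
    rw [Set.mem_preimage, Set.mem_ofPred_eq, Set.mem_ofPred_eq,
      Set.mem_smul_set_iff_inv_smul_mem₀ hpos.ne', Set.mem_inter_iff, SetLike.mem_coe,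
      Submodule.smul_mem_iff _ (inv_ne_zero hpos.ne'), and_comm]
    refine and_congr ?_ ?_
    · have hIoo : ∀ a : ℤ, ((n + 1 : ℕ) : ℝ)⁻¹ * a ∈ Set.Ioo (0 : ℝ) 1 ↔
          0 < a ∧ a < (n : ℤ) + 1 := by
        intro a
        rw [Set.mem_Ioo, inv_mul_lt_iff₀ hpos, mul_one, mul_pos_iff_of_pos_left (inv_pos.2 hpos)]
        norm_cast
      simp only [Sum.forall]
      rw [openCube, Set.mem_ofPred_eq]
      refine ⟨fun H => ?_, fun H => ?_⟩
      · exact fun i => Set.mk_mem_prod ((hIoo _).2 (H.1 i)) ((hIoo _).2 (H.2 i))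
      · exact ⟨fun i => (hIoo _).1 (H i).1, fun i => (hIoo _).1 (H i).2⟩
    · rw [essentialPart_eq_comap, Submodule.mem_comap]
      refine forall₂_congr fun c hc => ?_
      rw [← Int.cast_inj (α := ℝ)]
      push_cast
      refine Eq.congr (Finset.sum_congr rfl fun i _ => ?_) rfl
      rcases i with i | i <;> rfl
  rw [alpha, ehrhart, openCount, himage,
    Set.ncard_image_of_injective _ (pairEquiv ℤ (involvedPieces E)).injective]

end EssentialPart

/-- The counting function of a lattice in open cubes extends to a quasipolynomial with parity
symmetry. -/
theorem exists_isQuasipoly_extension {σ : Type*} [Fintype σ] {L : Submodule ℤ (σ → ℤ)}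
    (h1 : (fun _ => 1) ∈ L) :
    ∃ h : ℤ → ℚ, IsQuasipoly (Module.finrank ℤ L + 1) h ∧
      (∀ n, h (-n) = (-1) ^ Module.finrank ℤ L * h n) ∧
      ∀ n : ℕ, h n = openCount L (n + 1) := by
  rcases isEmpty_or_nonempty σ with hσ | hσ
  -- Without coordinates the single point is counted at every edge length, even nonpositive ones, so
  -- the symmetrized expression is of no use; the constant `1` is the extension.
  · have h0 : Module.finrank ℤ L = 0 := Module.finrank_zero_of_subsingleton
    rw [h0]
    refine ⟨fun _ => 1, ⟨1, one_pos, fun r => ⟨1, ?_, by simp⟩⟩, by simp, fun n => ?_⟩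
    · simp
    · have : {z : σ → ℤ | z ∈ L ∧ ∀ i, 0 < z i ∧ z i < (n : ℤ) + 1} = {fun _ => 1} := by
        ext z
        simp only [IsEmpty.forall_iff, and_true, Set.mem_singleton_iff]
        exact ⟨fun _ => Subsingleton.elim _ _, fun h => h ▸ h1⟩
      rw [openCount, this]
      simp
  · exact exists_isQuasipoly_openCount h1

/-! ### Degrees, parity and leading coefficients of the constituents -/

section Constituents

open Polynomial

lemma eq_of_eval_arithmetic_progression {f g : ℚ[X]} {a b : ℚ} (hb : b ≠ 0) (K : ℕ)
    (h : ∀ k : ℕ, K ≤ k → f.eval (a + b * k) = g.eval (a + b * k)) : f = g := by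
  refine eq_of_infinite_eval_eq f g ?_
  refine (Set.infinite_range_of_injective (f := fun k : ℕ => a + b * ((k + K : ℕ) : ℚ)) ?_).mono ?_
  · intro k k' hk
    have := mul_left_cancel₀ hb (add_left_cancel hk)
    have := Nat.cast_injective this
    omega
  · rintro _ ⟨k, rfl⟩
    exact h _ (Nat.le_add_left _ _)

lemma coeff_nonneg_of_eval_nonneg {f : ℚ[X]} {d : ℕ} (hf : f.degree ≤ d)
    (h : ∀ k : ℕ, 0 ≤ f.eval (k : ℚ)) : 0 ≤ f.coeff d := by
  by_contra! hneg
  have hdeg : f.degree = d := le_antisymm hf (le_degree_of_ne_zero hneg.ne)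
  rcases Nat.eq_zero_or_pos d with rfl | hd
  · rw [eq_C_of_degree_le_zero hf] at h
    have := h 0
    simp only [eval_C] at this
    linarith
  · have hlead : f.leadingCoeff ≤ 0 := by
      rw [leadingCoeff, natDegree_eq_of_degree_eq_some hdeg]
      exact hneg.le
    have hdeg' : 0 < f.degree := by
      rw [hdeg]
      exact_mod_cast hd
    have ht := (f.tendsto_atBot_of_leadingCoeff_nonpos hdeg' hlead).comp
      (tendsto_natCast_atTop_atTop (R := ℚ))
    obtain ⟨k, hk⟩ := (ht.eventually_lt_atBot 0).exists
    exact absurd (h k) (not_le.2 hk)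

lemma hasPeriod_of_isQuasipoly {f : ℕ → ℕ} {h : ℤ → ℚ} {m : ℕ} (hq : IsQuasipoly m h)
    (hf : ∀ n : ℕ, h n = f n) : ∃ p, HasPeriod f p := by
  obtain ⟨p, hp, hq⟩ := hq
  choose q _ hqe using hq
  have : NeZero p := ⟨hp.ne'⟩
  refine ⟨p, hp, fun i => (q i.val).comp (C ((p : ℚ)⁻¹) * X + C (-(i.val : ℚ) * (p : ℚ)⁻¹)),
    fun n => ?_⟩
  have h1 := hqe ((n : ZMod p).val) ((n / p : ℕ) : ℤ)
  have h2 : (((n : ZMod p).val : ℕ) : ℤ) + p * ((n / p : ℕ) : ℤ) = n := by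
    rw [ZMod.val_natCast]
    exact_mod_cast Nat.mod_add_div n p
  have h3 : (((n : ZMod p).val : ℕ) : ℚ) + p * ((n / p : ℕ) : ℚ) = n := by exact_mod_cast h2
  have hp' : (p : ℚ) ≠ 0 := by exact_mod_cast hp.ne'
  rw [h2, hf] at h1
  rw [h1, eval_comp]
  congr 1
  simp only [eval_add, eval_mul, eval_C, eval_X]
  rw [← h3, Int.cast_natCast]
  field_simp
  ring

section

variable {f : ℕ → ℕ} {h : ℤ → ℚ} {d p : ℕ} {c : ZMod p → ℚ[X]}

/-- The given period `p` need not be one of `h`. Both descriptions are polynomial along progressions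
of step `p₀ * p` and agree at infinitely many points of each, so the constituents inherit the degree
bound and also describe `h` at negative arguments. -/
lemma constituents_of_extension (hq : IsQuasipoly (d + 1) h) (hf : ∀ n : ℕ, h n = f n) (hp : 0 < p)
    (hc : IsQuasipolynomialWith f p c) :
    (∀ i, (c i).degree ≤ d) ∧ ∀ n : ℤ, h n = (c (n : ZMod p)).eval (n : ℚ) := by
  obtain ⟨p₀, hp₀, hq⟩ := hq
  have key : ∀ r : ℤ, (c (r : ZMod p)).degree ≤ d ∧ h r = (c (r : ZMod p)).eval (r : ℚ) := by
    intro r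
    obtain ⟨q, hqd, hqe⟩ := hq.mul p r
    have hP : ((p₀ * p : ℕ) : ℚ) ≠ 0 := by
      have : 0 < p₀ * p := by positivity
      exact_mod_cast this.ne'
    have heq : c (r : ZMod p) = q.comp (C (((p₀ * p : ℕ) : ℚ)⁻¹) * X +
        C (-(r : ℚ) * ((p₀ * p : ℕ) : ℚ)⁻¹)) := by
      -- From `k = |r|` on, the points of the progression are nonnegative, where `f` is defined.
      refine eq_of_eval_arithmetic_progression (a := r) hP r.natAbs fun k hk => ?_
      have hnn : 0 ≤ r + (p₀ * p : ℕ) * (k : ℤ) := by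
        have h1 : (1 : ℤ) * k ≤ (p₀ * p : ℕ) * (k : ℤ) := by
          refine mul_le_mul_of_nonneg_right ?_ (by positivity)
          have : 0 < p₀ * p := by positivity
          exact_mod_cast this
        omega
      obtain ⟨n, hn⟩ := Int.eq_ofNat_of_zero_le hnn
      have h1 := hqe k
      have h2 := hc n
      rw [hn, hf, h2] at h1
      have h3 : (n : ZMod p) = (r : ZMod p) := by
        have := congrArg (Int.cast : ℤ → ZMod p) hn
        push_cast at this
        simpa using this.symm
      have h4 : (r : ℚ) + (p₀ * p : ℕ) * k = n := by exact_mod_cast hn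
      rw [h4, ← h3, h1, eval_comp]
      congr 1
      simp only [eval_add, eval_mul, eval_C, eval_X]
      rw [← h4]
      field_simp
      push_cast
      ring
    constructor
    · rw [heq]
      have := degree_comp_linear_lt hqd (((p₀ * p : ℕ) : ℚ)⁻¹) (-(r : ℚ) * ((p₀ * p : ℕ) : ℚ)⁻¹)
      exact Order.lt_succ_iff.1 this
    · have h1 := hqe 0
      rw [mul_zero, add_zero] at h1
      rw [h1, heq, eval_comp]
      congr 1
      simp only [eval_add, eval_mul, eval_C, eval_X]
      push_cast
      ring
  refine ⟨fun i => ?_, fun n => (key n).2⟩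
  obtain ⟨r, rfl⟩ := ZMod.intCast_surjective i
  exact (key r).1

lemma parity_of_extension (hp : 0 < p) (hpar : ∀ n, h (-n) = (-1) ^ d * h n)
    (hc : ∀ n : ℤ, h n = (c (n : ZMod p)).eval (n : ℚ)) (i : ZMod p) (x : ℚ) :
    (c (-i)).eval (-x) = (-1) ^ d * (c i).eval x := by
  obtain ⟨r, rfl⟩ := ZMod.intCast_surjective i
  have hp' : (p : ℚ) ≠ 0 := by exact_mod_cast hp.ne'
  have heq : (c (-(r : ZMod p))).comp (-X) = C ((-1) ^ d) * c r := by
    refine eq_of_eval_arithmetic_progression (a := r) hp' 0 fun k _ => ?_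
    have h1 := hpar (r + p * k)
    rw [hc, hc] at h1
    push_cast at h1
    simp only [CharP.cast_eq_zero, zero_mul, add_zero] at h1
    simp only [eval_comp, eval_neg, eval_X, eval_mul, eval_C]
    exact h1
  have := congrArg (eval x) heq
  simpa using this

/-- For residues `i`, `j` the point `i + p k` lies below `j + p + p k`. Monotonicity compares the
coefficients of `k ^ d` in the two values, and the roles of `i` and `j` can be exchanged. -/
lemma leading_of_monotone (hp : 0 < p) (hdeg : ∀ i, (c i).degree ≤ d) (hf : Monotone f)
    (hc : IsQuasipolynomialWith f p c) (i j : ZMod p) : (c i).coeff d = (c j).coeff d := by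
  have : NeZero p := ⟨hp.ne'⟩
  have hp' : (0 : ℚ) < p := by exact_mod_cast hp
  have key : ∀ i j : ZMod p, (c i).coeff d ≤ (c j).coeff d := by
    intro i j
    have h1 : 0 ≤ ((c j).comp (C (p : ℚ) * X + C ((j.val : ℚ) + p)) -
        (c i).comp (C (p : ℚ) * X + C (i.val : ℚ))).coeff d := by
      refine coeff_nonneg_of_eval_nonneg ?_ fun k => ?_
      · refine (degree_sub_le _ _).trans (max_le ?_ ?_) <;>
        exact Order.lt_succ_iff.1 (degree_comp_linear_lt (Order.lt_succ_iff.2 (hdeg _) :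
          _ < ((d + 1 : ℕ) : WithBot ℕ)) _ _)
      · have hle : i.val + p * k ≤ j.val + p + p * k := by
          have := i.val_lt
          omega
        have h2 : (f (i.val + p * k) : ℚ) ≤ f (j.val + p + p * k) := by exact_mod_cast hf hle
        rw [hc, hc] at h2
        push_cast at h2
        simp only [CharP.cast_eq_zero, zero_mul, add_zero, ZMod.natCast_val, ZMod.cast_id',
          id_eq] at h2
        simp only [eval_sub, eval_comp, eval_add, eval_mul, eval_C, eval_X]
        have e1 : (p : ℚ) * k + i.val = i.val + p * k := by ring
        have e2 : (p : ℚ) * k + (j.val + p) = j.val + p + p * k := by ring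
        rw [e1, e2]
        simp only [ZMod.natCast_val] at h2 ⊢
        linarith
    rw [coeff_sub, coeff_comp_linear (hdeg _), coeff_comp_linear (hdeg _), ← mul_sub] at h1
    exact sub_nonneg.1 ((mul_nonneg_iff_of_pos_left (by positivity)).1 h1)
  exact le_antisymm (key i j) (key j i)

/-- With `m = p k` the argument `2 * B * m + 1` is congruent to `1`, so only the constituent `c 1`
enters; the coefficient of `k ^ d` is then at least `p ^ d`. -/
lemma coeff_pos_of_pow_le (hp : 0 < p) (hdeg : ∀ i, (c i).degree ≤ d)
    (hc : IsQuasipolynomialWith f p c) {B : ℕ} (hB : 0 < B)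
    (hlow : ∀ m : ℕ, m ^ d ≤ f (2 * B * m + 1)) : 0 < (c 1).coeff d := by
  have hp' : (0 : ℚ) < p := by exact_mod_cast hp
  have hB' : (0 : ℚ) < B := by exact_mod_cast hB
  have h1 : 0 ≤ ((c 1).comp (C (2 * B * p : ℚ) * X + C 1) -
      (X ^ d : ℚ[X]).comp (C (p : ℚ) * X + C 0)).coeff d := by
    refine coeff_nonneg_of_eval_nonneg ?_ fun k => ?_
    · refine (degree_sub_le _ _).trans (max_le ?_ ?_)
      · exact Order.lt_succ_iff.1 (degree_comp_linear_lt (Order.lt_succ_iff.2 (hdeg _) :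
          _ < ((d + 1 : ℕ) : WithBot ℕ)) _ _)
      · exact Order.lt_succ_iff.1 (degree_comp_linear_lt (Order.lt_succ_iff.2 (degree_X_pow_le d) :
          _ < ((d + 1 : ℕ) : WithBot ℕ)) _ _)
    · have h2 : (((p * k : ℕ) ^ d : ℕ) : ℚ) ≤ f (2 * B * (p * k) + 1) := by
        exact_mod_cast hlow (p * k)
      rw [hc] at h2
      push_cast at h2
      simp only [CharP.cast_eq_zero, zero_mul, mul_zero, zero_add] at h2
      simp only [eval_sub, eval_comp, eval_add, eval_mul, eval_C, eval_X, eval_pow, add_zero,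
        sub_nonneg]
      have e1 : (2 * B * p : ℚ) * k + 1 = 2 * B * (p * k) + 1 := by ring
      rw [e1]
      exact h2
  rw [coeff_sub, coeff_comp_linear (hdeg _), coeff_comp_linear (degree_X_pow_le d), coeff_X_pow,
    if_pos rfl, mul_one] at h1
  have h3 : (0 : ℚ) < p ^ d := by positivity
  have h4 : (0 : ℚ) < (2 * B * p) ^ d * (c 1).coeff d := by linarith
  exact (mul_pos_iff_of_pos_left (by positivity)).1 h4

end

end Constituents

/-! ### How many values determine a system with parity symmetry -/

section ParitySystems

open Polynomial

lemma natCeil_half (m : ℕ) : ⌈(m : ℚ) / 2⌉₊ = (m + 1) / 2 := by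
  rcases Nat.even_or_odd' m with ⟨e, rfl | rfl⟩
  · have : ((2 * e : ℕ) : ℚ) / 2 = (e : ℕ) := by push_cast; ring
    rw [this, Nat.ceil_natCast]
    omega
  · have h : (2 * e + 1 + 1) / 2 = e + 1 := by omega
    rw [h, Nat.ceil_eq_iff (by omega)]
    push_cast
    constructor
    · linarith
    · linarith

lemma numValues_eq {p κ ν d : ℕ} (h : d + ν = 2 * κ) :
    numValues p κ ν = (p * d + 1) / 2 + if Even d then 1 else 0 := by
  have h1 : (p : ℚ) * ((κ : ℚ) - (ν : ℚ) / 2) = ((p * d : ℕ) : ℚ) / 2 := by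
    have : (d : ℚ) + ν = 2 * κ := by exact_mod_cast h
    push_cast
    linear_combination (-(p : ℚ) / 2) * this
  have h2 : Even ν ↔ Even d := by
    have : Even (d + ν) := h ▸ even_two_mul κ
    exact (Nat.even_add.1 this).symm
  rw [numValues, h1, natCeil_half]
  simp only [h2]

/-- Among `p * d` consecutive integers, each residue class has `d` members, enough for a polynomial
of degree less than `d`. -/
lemma eq_zero_of_eval_interval {p d : ℕ} (hp : 0 < p) {f : ℚ[X]} (hf : f.degree < d) (i : ZMod p)
    (s : ℤ) (h : ∀ n : ℤ, s ≤ n → n < s + p * d → (n : ZMod p) = i → f.eval (n : ℚ) = 0) :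
    f = 0 := by
  obtain ⟨r, rfl⟩ := ZMod.intCast_surjective i
  have hp' : (p : ℤ) ≠ 0 := by exact_mod_cast hp.ne'
  have hpos : (0 : ℤ) < p := by exact_mod_cast hp
  refine eq_zero_of_degree_lt_of_eval_index_eq_zero (R := ℚ) (s := Finset.range d)
    (v := fun j : ℕ => ((s + (r - s) % p + p * j : ℤ) : ℚ)) ?_ (by simpa using hf) fun j hj => ?_
  · intro j _ j' _ hjj
    have h1 : s + (r - s) % p + p * (j : ℤ) = s + (r - s) % p + p * (j' : ℤ) := Int.cast_injective hjj
    have h2 := mul_left_cancel₀ hp' (add_left_cancel h1)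
    exact_mod_cast h2
  · have hj' : (j : ℤ) + 1 ≤ d := by exact_mod_cast Finset.mem_range.1 hj
    have h1 := Int.emod_nonneg (r - s) hp'
    have h2 := Int.emod_lt_of_pos (r - s) hpos
    have h3 : (p : ℤ) * (j + 1) ≤ p * d := mul_le_mul_of_nonneg_left hj' hpos.le
    have h4 : (0 : ℤ) ≤ p * j := by positivity
    refine h _ (by linarith) (by linarith) ?_
    have h5 : s + (r - s) % p + p * (j : ℤ) = r + p * (j - (r - s) / p) := by
      have := Int.emod_add_mul_ediv (r - s) p
      linear_combination this
    rw [h5]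
    push_cast
    simp

lemma degree_lt_of_coeff_eq_zero {f : ℚ[X]} {d : ℕ} (hf : f.degree ≤ d) (h : f.coeff d = 0) :
    f.degree < d := by
  refine lt_of_le_of_ne hf fun heq => ?_
  exact coeff_ne_zero_of_eq_degree heq h

variable {p d : ℕ}

lemma IsParitySystem.sub {c c' : ZMod p → ℚ[X]} (hc : IsParitySystem p d c)
    (hc' : IsParitySystem p d c') : IsParitySystem p d (c - c') where
  degree_le i := (degree_sub_le _ _).trans (max_le (hc.degree_le i) (hc'.degree_le i))
  leading_eq i j := by
    simp only [Pi.sub_apply, coeff_sub, hc.leading_eq i j, hc'.leading_eq i j]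
  parity i x := by
    simp only [Pi.sub_apply, eval_sub, hc.parity, hc'.parity]
    ring

lemma IsParitySystem.add_smul {c c' : ZMod p → ℚ[X]} (hc : IsParitySystem p d c)
    (hc' : IsParitySystem p d c') (r : ℚ) : IsParitySystem p d (c + r • c') where
  degree_le i := (degree_add_le _ _).trans
    (max_le (hc.degree_le i) ((degree_smul_le r _).trans (hc'.degree_le i)))
  leading_eq i j := by
    simp only [Pi.add_apply, Pi.smul_apply, coeff_add, coeff_smul, hc.leading_eq i j,
      hc'.leading_eq i j]
  parity i x := by
    simp only [Pi.add_apply, Pi.smul_apply, eval_add, eval_smul, smul_eq_mul, hc.parity, hc'.parity]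
    ring

/-- The number of consecutive values that determine a parity system. -/
lemma IsParitySystem.eq_zero (hp : 0 < p) {c : ZMod p → ℚ[X]} (hc : IsParitySystem p d c)
    (h : ∀ n ∈ Finset.Icc 1 ((p * d + 1) / 2 + if Even d then 1 else 0),
      (c (n : ZMod p)).eval (n : ℚ) = 0) : c = 0 := by
  classical
  have : NeZero p := ⟨hp.ne'⟩
  set N := (p * d + 1) / 2 + if Even d then 1 else 0 with hN
  have hpos : ∀ n : ℕ, 1 ≤ n → n ≤ N → (c (n : ZMod p)).eval (n : ℚ) = 0 := fun n h1 h2 =>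
    h n (Finset.mem_Icc.2 ⟨h1, h2⟩)
  have hz : ∀ n : ℤ, n ≠ 0 → |n| ≤ N → (c (n : ZMod p)).eval (n : ℚ) = 0 := by
    intro n hn0 hn
    obtain ⟨m, rfl | rfl⟩ := n.eq_nat_or_neg
    · simp only [Nat.abs_cast, Nat.cast_le] at hn
      have := hpos m (by omega) hn
      simpa using this
    · simp only [abs_neg, Nat.abs_cast, Nat.cast_le] at hn
      have h1 := hpos m (by omega) hn
      have h2 := hc.parity m m
      rw [h1, mul_zero] at h2
      push_cast
      exact h2
  -- For odd `d` the parity at the fixed point `0` gives a zero for free. For even `d` it gives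
  -- nothing, whence the extra value in `N`.
  have hodd : ¬ Even d → (c 0).eval 0 = 0 := by
    intro hd
    have := hc.parity 0 0
    rw [(Nat.not_even_iff_odd.1 hd).neg_one_pow] at this
    simp only [neg_zero] at this
    linarith
  let Z : Finset ℤ := (Finset.Icc (-(N : ℤ)) N).filter fun n => (c (n : ZMod p)).eval (n : ℚ) = 0
  have hcard : p * d < Z.card := by
    by_cases hd : Even d
    · have hsub : (Finset.Icc (-(N : ℤ)) N).erase 0 ⊆ Z := by
        intro n hn
        obtain ⟨h0, hn⟩ := Finset.mem_erase.1 hn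
        exact Finset.mem_filter.2 ⟨hn, hz n h0 (abs_le.2 (Finset.mem_Icc.1 hn))⟩
      have h1 := Finset.card_le_card hsub
      rw [Finset.card_erase_of_mem (by simp), Int.card_Icc] at h1
      rw [if_pos hd] at hN
      omega
    · have hsub : Finset.Icc (-(N : ℤ)) N ⊆ Z := by
        intro n hn
        refine Finset.mem_filter.2 ⟨hn, ?_⟩
        rcases eq_or_ne n 0 with rfl | h0
        · simpa using hodd hd
        · exact hz n h0 (abs_le.2 (Finset.mem_Icc.1 hn))
      have h1 := Finset.card_le_card hsub
      rw [Int.card_Icc] at h1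
      rw [if_neg hd] at hN
      omega
  obtain ⟨i, -, hi⟩ := Finset.exists_lt_card_fiber_of_mul_lt_card_of_maps_to
    (s := Z) (t := (Finset.univ : Finset (ZMod p))) (f := fun n => (n : ZMod p)) (n := d)
    (fun _ _ => Finset.mem_univ _) (by simpa [ZMod.card] using hcard)
  have hci : c i = 0 := by
    refine eq_zero_of_degree_lt_of_eval_index_eq_zero (R := ℚ)
      (s := Z.filter fun n : ℤ => (n : ZMod p) = i) (v := fun n : ℤ => (n : ℚ))
      (Int.cast_injective.injOn) (lt_of_le_of_lt (hc.degree_le i) (by exact_mod_cast hi)) ?_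
    intro n hn
    obtain ⟨hnZ, rfl⟩ := Finset.mem_filter.1 hn
    exact (Finset.mem_filter.1 hnZ).2
  have hdeg : ∀ j, (c j).degree < d := fun j =>
    degree_lt_of_coeff_eq_zero (hc.degree_le j) (by rw [hc.leading_eq j i, hci, coeff_zero])
  ext1 j
  -- Only here may the value at `0` be unknown. The `d` nonzero multiples `±p, …, ±p * (d / 2)`
  -- replace the interval of consecutive integers.
  by_cases hj : Even d ∧ j = 0
  · obtain ⟨⟨e, rfl⟩, rfl⟩ := hj
    have hNe : p * e ≤ N := by
      rw [hN, mul_add]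
      omega
    refine eq_zero_of_degree_lt_of_eval_index_eq_zero (R := ℚ)
      (s := (Finset.Icc (-(e : ℤ)) e).erase 0) (v := fun n : ℤ => ((p * n : ℤ) : ℚ)) ?_ ?_ ?_
    · intro n _ n' _ hnn
      have h1 : (p : ℤ) * n = p * n' := Int.cast_injective hnn
      exact mul_left_cancel₀ (by exact_mod_cast hp.ne') h1
    · rw [Finset.card_erase_of_mem (by simp), Int.card_Icc]
      refine lt_of_lt_of_le (hdeg 0) (Nat.cast_le.2 ?_)
      omega
    · intro n hn
      obtain ⟨h0, hn⟩ := Finset.mem_erase.1 hn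
      have h1 := hz (p * n) (mul_ne_zero (by exact_mod_cast hp.ne') h0) (by
        rw [abs_mul, Nat.abs_cast]
        calc (p : ℤ) * |n| ≤ p * e :=
              mul_le_mul_of_nonneg_left (abs_le.2 (Finset.mem_Icc.1 hn)) (by positivity)
          _ ≤ N := by exact_mod_cast hNe)
      simpa using h1
  · refine eq_zero_of_eval_interval hp (hdeg j) j (-(N : ℤ)) fun n h1 h2 hnj => ?_
    have h3 : n ≤ N := by
      have h4 : p * d ≤ 2 * N := by omega
      have h5 : (p : ℤ) * d ≤ 2 * N := by exact_mod_cast h4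
      linarith
    subst hnj
    rcases eq_or_ne n 0 with rfl | h0
    · have hd : ¬ Even d := fun hd => hj ⟨hd, by simp⟩
      simpa using hodd hd
    · exact hz n h0 (abs_le.2 ⟨h1, h3⟩)

/-- The systems of polynomials of degree at most `d` with a common coefficient of degree `d`,
parametrized by this coefficient and the remaining ones. -/
noncomputable def systemOfCoeffs (p d : ℕ) :
    (ℚ × (ZMod p → Fin d → ℚ)) →ₗ[ℚ] (ZMod p → ℚ[X]) where
  toFun v i := monomial d v.1 + ((degreeLTEquiv ℚ d).symm (v.2 i) : ℚ[X])
  map_add' v v' := by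
    ext1 i
    simp only [Prod.fst_add, Prod.snd_add, Pi.add_apply, map_add, Submodule.coe_add]
    abel
  map_smul' r v := by
    ext1 i
    simp [smul_add, smul_monomial]

lemma systemOfCoeffs_degree_lt (v : ZMod p → Fin d → ℚ) (i : ZMod p) :
    ((degreeLTEquiv ℚ d).symm (v i) : ℚ[X]).degree < d :=
  mem_degreeLT.1 ((degreeLTEquiv ℚ d).symm (v i)).2

lemma systemOfCoeffs_coeff (v : ℚ × (ZMod p → Fin d → ℚ)) (i : ZMod p) :
    (systemOfCoeffs p d v i).coeff d = v.1 := by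
  have := coeff_eq_zero_of_degree_lt (systemOfCoeffs_degree_lt v.2 i)
  simp [systemOfCoeffs, this]

lemma systemOfCoeffs_degree_le (v : ℚ × (ZMod p → Fin d → ℚ)) (i : ZMod p) :
    (systemOfCoeffs p d v i).degree ≤ d :=
  (degree_add_le _ _).trans (max_le (degree_monomial_le _ _) (systemOfCoeffs_degree_lt v.2 i).le)

lemma systemOfCoeffs_injective : Function.Injective (systemOfCoeffs p d) := by
  intro v v' h
  have h1 : v.1 = v'.1 := by
    rw [← systemOfCoeffs_coeff v 0, h, systemOfCoeffs_coeff]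
  refine Prod.ext h1 (funext fun i => ?_)
  have h2 := congrFun h i
  simp only [systemOfCoeffs, LinearMap.coe_mk, AddHom.coe_mk, h1] at h2
  exact (degreeLTEquiv ℚ d).symm.injective (Subtype.ext (add_left_cancel h2))

/-- Fewer values than parameters do not determine a parity system. -/
lemma exists_isParitySystem_ne_zero (hp : 0 < p) (S : Finset ℕ)
    (hS : S.card < (p * d + 1) / 2 + if Even d then 1 else 0) :
    ∃ c : ZMod p → ℚ[X], IsParitySystem p d c ∧ c ≠ 0 ∧
      ∀ n ∈ S, (c (n : ZMod p)).eval (n : ℚ) = 0 := by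
  have : NeZero p := ⟨hp.ne'⟩
  let ev : ZMod p → ℚ → (ZMod p → ℚ[X]) →ₗ[ℚ] ℚ := fun i x => leval x ∘ₗ LinearMap.proj i
  set ε : ℕ := if Even d then 1 else 0 with hε
  -- `M` conditions at `n = ε, …, ⌊pd/2⌋` enforce parity; for even `d` the one at `0` is automatic.
  -- Together with at most `N - 1` prescribed zeros they number at most `pd`, one less than the
  -- parameters.
  let M := p * d / 2 + 1 - ε
  -- On a parity system this functional is twice the value at `s`.
  let sym : S → (ZMod p → ℚ[X]) →ₗ[ℚ] ℚ := fun s =>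
    ev (s : ℕ) (s : ℕ) + (-1 : ℚ) ^ d • ev (-(s : ℕ)) (-(s : ℕ))
  let anti : Fin M → (ZMod p → ℚ[X]) →ₗ[ℚ] ℚ := fun j =>
    ev (j + ε : ℕ) (j + ε : ℕ) - (-1 : ℚ) ^ d • ev (-(j + ε : ℕ)) (-(j + ε : ℕ))
  let F := (LinearMap.prod (LinearMap.pi sym) (LinearMap.pi anti)) ∘ₗ systemOfCoeffs p d
  have hpd : Even d → p * d % 2 = 0 := fun hd => Nat.even_iff.1 (hd.mul_left p)
  have hker : LinearMap.ker F ≠ ⊥ := by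
    refine LinearMap.ker_ne_bot_of_finrank_lt ?_
    simp only [Module.finrank_prod, Module.finrank_fintype_fun_eq_card, Fintype.card_coe,
      Fintype.card_fin, Module.finrank_self, Module.finrank_pi_fintype, Finset.sum_const,
      Finset.card_univ, ZMod.card, smul_eq_mul]
    by_cases hd : Even d
    · have := hpd hd
      simp only [M, hε, if_pos hd] at hS ⊢
      omega
    · simp only [M, hε, if_neg hd] at hS ⊢
      omega
  obtain ⟨v, hv, hv0⟩ := Submodule.exists_mem_ne_zero_of_ne_bot hker
  set c := systemOfCoeffs p d v
  have hF : F v = 0 := hv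
  have hsym : ∀ s ∈ S, (c (s : ZMod p)).eval (s : ℚ) +
      (-1) ^ d * (c (-(s : ZMod p))).eval (-(s : ℚ)) = 0 := fun s hs =>
    congrFun (congrArg Prod.fst hF) ⟨s, hs⟩
  have hanti : ∀ j : ℕ, j < M → (c ((j + ε : ℕ) : ZMod p)).eval ((j + ε : ℕ) : ℚ) -
      (-1) ^ d * (c (-((j + ε : ℕ) : ZMod p))).eval (-((j + ε : ℕ) : ℚ)) = 0 := fun j hj =>
    congrFun (congrArg Prod.snd hF) ⟨j, hj⟩
  have hsq : ((-1 : ℚ) ^ d) * (-1) ^ d = 1 := by rw [← mul_pow]; simp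
  -- The defect of parity. The common leading coefficient cancels in it, so its degree is below `d`;
  -- it is antisymmetric up to sign, so its zeros at `0, …, ⌊pd/2⌋` reflect and fill an interval of
  -- `p * d` integers.
  let g : ZMod p → ℚ[X] := fun i => c i - C ((-1) ^ d) * (c (-i)).comp (C (-1) * X + C 0)
  have hgeval : ∀ i x, (g i).eval x = (c i).eval x - (-1) ^ d * (c (-i)).eval (-x) := by
    intro i x
    simp [g]
  have hgdeg : ∀ i, (g i).degree < d := by
    intro i
    have hcomp : ((c (-i)).comp (C (-1) * X + C 0)).degree ≤ d :=
      Order.lt_succ_iff.1 (degree_comp_linear_lt (Order.lt_succ_iff.2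
        (systemOfCoeffs_degree_le v (-i)) : _ < ((d + 1 : ℕ) : WithBot ℕ)) _ _)
    refine degree_lt_of_coeff_eq_zero ?_ ?_
    · refine (degree_sub_le _ _).trans (max_le (systemOfCoeffs_degree_le v i) ?_)
      exact (degree_mul_le _ _).trans
        ((add_le_add degree_C_le hcomp).trans (by rw [zero_add]))
    · simp only [g]
      rw [coeff_sub, coeff_C_mul, coeff_comp_linear (systemOfCoeffs_degree_le v (-i)),
        systemOfCoeffs_coeff, systemOfCoeffs_coeff, ← mul_assoc, hsq, one_mul, sub_self]
  have hgz_nat : ∀ n : ℕ, n ≤ p * d / 2 → (g n).eval (n : ℚ) = 0 := by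
    intro n hn
    rw [hgeval]
    by_cases hn0 : Even d ∧ n = 0
    · obtain ⟨hd, rfl⟩ := hn0
      simp [hd.neg_one_pow]
    · have hεn : ε ≤ n := by
        by_cases hd : Even d
        · simp only [hε, if_pos hd]
          have : n ≠ 0 := fun h => hn0 ⟨hd, h⟩
          omega
        · simp [hε, if_neg hd]
      have := hanti (n - ε) (by omega)
      rwa [Nat.sub_add_cancel hεn] at this
  have hg : ∀ i, g i = 0 := by
    intro i
    refine eq_zero_of_eval_interval hp (hgdeg i) i (-((p * d / 2 : ℕ) : ℤ)) fun n h1 h2 hni => ?_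
    subst hni
    have h3 : n ≤ ((p * d / 2 : ℕ) : ℤ) := by
      have h4 : p * d ≤ 2 * (p * d / 2) + 1 := by omega
      have h5 : (p : ℤ) * d ≤ 2 * ((p * d / 2 : ℕ) : ℤ) + 1 := by exact_mod_cast h4
      linarith
    obtain ⟨m, rfl | rfl⟩ := n.eq_nat_or_neg
    · simpa using hgz_nat m (by omega)
    · have h6 := hgz_nat m (by omega)
      rw [hgeval] at h6 ⊢
      push_cast
      rw [neg_neg, neg_neg]
      linear_combination (-(-1 : ℚ) ^ d) * h6 - (c (-(m : ZMod p))).eval (-(m : ℚ)) * hsq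
  have hpar : ∀ i x, (c i).eval x = (-1) ^ d * (c (-i)).eval (-x) := by
    intro i x
    have := hgeval i x
    rw [hg i, eval_zero] at this
    linarith
  refine ⟨c, ⟨systemOfCoeffs_degree_le v, fun i j => ?_, fun i x => ?_⟩, fun h0 => hv0 ?_, ?_⟩
  · rw [systemOfCoeffs_coeff, systemOfCoeffs_coeff]
  · rw [hpar (-i) (-x), neg_neg, neg_neg]
  · exact systemOfCoeffs_injective (h0.trans (map_zero _).symm)
  · intro s hs
    have h1 := hsym s hs
    rw [← hpar] at h1
    linarith

end ParitySystems

/-! ### The theorem -/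

theorem theoremT (M : Finset (ℤ × ℤ)) (hM : IsMoveSet M) (q : ℕ) (hq : 0 < q)
    (E : Set (Fin q × Fin q × (ℤ × ℤ))) (hE : E ⊆ attackEquations M q)
    (U : Submodule ℝ (Fin q → ℝ × ℝ)) (hU : U = attackSubspace E)
    (κ : ℕ) (hκ : κ = (involvedPieces E).ncard) :
    -- `α(U; n)` is a quasipolynomial
    (∃ p : ℕ, HasPeriod (alpha E) p) ∧
    ∀ p : ℕ, HasPeriod (alpha E) p →
      ∃ (d : ℕ) (c : ZMod p → Polynomial ℚ),
        d + codim U = 2 * κ ∧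
        -- its constituents: degree `d`, common leading coefficient, parity symmetry
        IsQuasipolynomialWith (alpha E) p c ∧
        (∀ i, (c i).degree = (d : WithBot ℕ)) ∧
        IsParitySystem p d c ∧
        -- the first `numValues p κ (codim U)` values determine all constituents
        (∀ c' : ZMod p → Polynomial ℚ, IsParitySystem p d c' →
          (∀ n ∈ Finset.Icc 1 (numValues p κ (codim U)),
            (c' (n : ZMod p)).eval (n : ℚ) = (alpha E n : ℚ)) →
          c' = c) ∧
        -- fewer values, wherever they are taken, never do
        (∀ S : Finset ℕ, S.card < numValues p κ (codim U) →
          ∃ c' : ZMod p → Polynomial ℚ, IsParitySystem p d c' ∧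
            (∀ i, (c' i).degree = (d : WithBot ℕ)) ∧
            (∀ n ∈ S, (c' (n : ZMod p)).eval (n : ℚ) = (alpha E n : ℚ)) ∧
            c' ≠ c) := by
  classical
  subst hU hκ
  have : Fintype (involvedPieces E) := Fintype.ofFinite _
  set L := orthogonalSubmodule ℤ (equationVectors E)
  have h1 : (fun _ => 1) ∈ L := one_mem_orthogonalSubmodule E
  have hαL : ∀ n, alpha E n = openCount L (n + 1) := alpha_eq_openCount E
  have hd : Module.finrank ℤ L + codim (attackSubspace E) = 2 * (involvedPieces E).ncard :=
    finrank_add_codim E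
  set d := Module.finrank ℤ L
  obtain ⟨h, hq, hpar, hhL⟩ := exists_isQuasipoly_extension h1
  have hα : ∀ n : ℕ, h n = alpha E n := fun n => by rw [hhL, hαL]
  have hmono : Monotone (alpha E) := fun m n hmn => by
    rw [hαL, hαL]
    exact openCount_mono L (by omega)
  obtain ⟨B, hB, hlow⟩ := exists_pow_le_openCount h1
  refine ⟨hasPeriod_of_isQuasipoly hq hα, fun p hperiod => ?_⟩
  obtain ⟨hp, c, hc⟩ := hperiod
  obtain ⟨hdeg, hext⟩ := constituents_of_extension hq hα hp hc
  have hsys : IsParitySystem p d c :=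
    ⟨hdeg, leading_of_monotone hp hdeg hmono hc, parity_of_extension hp hpar hext⟩
  have hlead : 0 < (c 1).coeff d := by
    refine coeff_pos_of_pow_le hp hdeg hc hB fun m => ?_
    rw [hαL]
    convert hlow m using 2
    push_cast
    ring
  rw [numValues_eq hd]
  refine ⟨d, c, hd, hc, fun i => ?_, hsys, fun c' hc' hval => ?_, fun S hS => ?_⟩
  · refine le_antisymm (hdeg i) (Polynomial.le_degree_of_ne_zero ?_)
    rw [hsys.leading_eq i 1]
    exact hlead.ne'
  · refine sub_eq_zero.1 ((hc'.sub hsys).eq_zero hp fun n hn => ?_)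
    rw [Pi.sub_apply, Polynomial.eval_sub, hval n hn, hc n, sub_self]
  · obtain ⟨δ, hδ, hδ0, hδS⟩ := exists_isParitySystem_ne_zero hp S hS
    -- The perturbation must keep the degree exactly `d`. The leading coefficient of `c` is nonzero,
    -- so adding and subtracting that of `δ` cannot both cancel it, and `r = 1` or `r = -1` works.
    obtain ⟨r, hr, hne⟩ : ∃ r : ℚ, r ≠ 0 ∧ (c 1).coeff d + r * (δ 1).coeff d ≠ 0 := by
      by_cases h0 : (c 1).coeff d + 1 * (δ 1).coeff d = 0
      · exact ⟨-1, by norm_num, fun h2 => hlead.ne' (by linarith)⟩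
      · exact ⟨1, one_ne_zero, h0⟩
    have hsys' := hsys.add_smul hδ r
    refine ⟨c + r • δ, hsys', fun i => ?_, fun n hn => ?_, fun heq => ?_⟩
    · refine le_antisymm (hsys'.degree_le i) (Polynomial.le_degree_of_ne_zero ?_)
      rw [hsys'.leading_eq i 1]
      simpa using hne
    · rw [Pi.add_apply, Pi.smul_apply, Polynomial.eval_add, Polynomial.eval_smul, hδS n hn,
        smul_zero, add_zero, hc n]
    · exact hδ0 ((smul_eq_zero.1 (left_eq_add.1 heq.symm)).resolve_left hr)
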